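/- Let $\mathbb F$ be a field of characteristic $0$, $n\ge 1$, and $\mathcal J_p\in\{\{0\},\mathbb N\}$ for $1\le p\le 2n$; put $\mathcal J=\mathcal J_1\times\cdots\times\mathcal J_{2n}$. Let $\Gamma$ be a nonzero torsion-free abelian group, $\phi:\Gamma\times\Gamma\to\mathbb F$ a skew-symmetric $\mathbb Z$-bilinear form with radical $\mathrm{Rad}_\phi$, and $\varphi_1,\dots,\varphi_{2n}:\Gamma\to\mathbb F$ additive homomorphisms such that * $\varphi_p(\Gamma)+\mathcal J_p\neq\{0\}$ for every $p$; * $\mathrm{Rad}_\phi\cap\bigcap_p\ker\varphi_p=\{0\}$; * for every $q$ with $\varphi_q\not\equiv 0$ there is an element of $\mathrm{Rad}_\phi\cap\bigcap_{p\ne q}\ker\varphi_p$ outside $\ker\varphi_q$. For $1\le s\le n-1$ fix $\sigma_{2s+1}\in\mathrm{Rad}_\phi\cap\bigcap_{p\ne 2s+1,2s+2}\ker\varphi_p$, with $\sigma_{2s+1}\neq 0$ if $\varphi_{2s+1}\not\equiv0$ or $\varphi_{2s+2}\not\equiv 0$, and let $\varepsilon\in\mathrm{Rad}_\phi\cap\bigcap_{p=2}^{2n}\ker\varphi_p$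 satisfy $\varphi_1(\varepsilon)=1$. Let $\mathscr A$ be the commutative $\mathbb F$-algebra with basis $x^{\alpha,\mathbf i}$, $(\alpha,\mathbf i)\in\Gamma\times\mathcal J$, and product $x^{\alpha,\mathbf i}x^{\beta,\mathbf j}=x^{\alpha+\beta,\mathbf i+\mathbf j}$; let $\mathscr A_\alpha$ be the span of the $x^{\alpha,\mathbf j}$, $\mathbf j\in\mathcal J$, and let $\partial_p$ be the derivation $\partial_p(x^{\alpha,\mathbf i})=\varphi_p(\alpha)x^{\alpha,\mathbf i}+i_p\,x^{\alpha,\mathbf i-1_{[p]}}$, where $1_{[p]}$ is the $p$-th unit vector and the last term is $0$ if $i_p=0$. Then $\mathscr A$ is a Lie algebra under the bracket given, for $u\in\mathscr A_\alpha$, $w\in\mathscr A_\beta$, by $$[u,w]=x^{\varepsilon,\mathbf 0}\Big(\sum_{s=1}^{n-1}x^{\sigma_{2s+1},\mathbf 0}\big(\partial_{2s+1}(u)\partial_{2s+2}(w)-\partial_{2s+1}(w)\partial_{2s+2}(u)\big)+\phi(\alpha,\beta)uw\Big)+(\partial_1+1)(u)\,\partial_2(w)-(\partial_1+1)(w)\,\partial_2(u),$$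 the element $x^{-\varepsilon,\mathbf 0}$ is central, and $\mathscr H=\mathscr A/\mathbb Fx^{-\varepsilon,\mathbf 0}$ is a Lie algebra; write $\bar u$ for the class of $u$. For $\vec\xi=(\xi_1,\dots,\xi_{2n})\in\mathbb F^{2n}$ and an additive homomorphism $f:\Gamma\to\mathbb F$ with $\mathrm{Rad}_\phi\subset\ker f$, let $\mathscr A_{\vec\xi,f}$ be the $\mathscr H$-module with underlying space $\mathscr A$ and action given, for $u\in\mathscr A_\alpha$, $v\in\mathscr A_\beta$, by $$\bar u.v=x^{\varepsilon,\mathbf 0}\Big(\sum_{s=1}^{n-1}x^{\sigma_{2s+1},\mathbf 0}\big(\partial_{2s+1}(u)(\partial_{2s+2}+\xi_{2s+2})(v)-\partial_{2s+2}(u)(\partial_{2s+1}+\xi_{2s+1})(v)\big)+(\phi(\alpha,\beta)+f(\alpha))uv\Big)+(\partial_1+1)(u)(\partial_2+\xi_2)(v)-\partial_2(u)(\partial_1+\xi_1)(v).$$ Let $\vec\xi_0=(1,0,\dots,0)$. Then $\mathscr A_{\vec\xi_0,0}$ is the module induced from the adjoint representation of $\mathscr A$, that is, $\bar u.v=[u,v]$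 in it, and the following holds. If there is $\mu\in\Gamma$ such that $\xi_p=\varphi_p(\mu)$ for all $p$ and $f(\alpha)=\phi(\alpha,\mu)$ for all $\alpha\in\Gamma$, then $\mathscr A_{\vec\xi,f}\cong\mathscr A_{\vec\xi_0,0}$ as $\mathscr H$-modules. Otherwise $\mathscr A_{\vec\xi,f}$ is an irreducible $\mathscr H$-module. -/

import Mathlib

/-- The data from which a twisted Hamiltonian Lie algebra is built.  The positive integer `n` of
the mathematics is `m + 1`, and the index set `{1, …, 2n}` is `Fin (m + 1) × Fin 2`: the pair
`(s, 0)` stands for the index `2s + 1` and `(s, 1)` for `2s + 2`, where `0 ≤ s ≤ m = n - 1`.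
Thus `(0, 0)` and `(0, 1)` are the indices `1` and `2`.  The pairs with `1 ≤ s ≤ n - 1` are
`(s.succ, _)` with `s : Fin m`, and `σ s` is the common value of `σ` at such a pair of indices. -/
structure TwistedDatum (F : Type*) [Field F] (m : ℕ) (Γ : Type*) [AddCommGroup Γ] where
  /-- the semigroups `𝒥_p`, each equal to `{0}` or to `ℕ` -/
  J : Fin (m + 1) × Fin 2 → AddSubmonoid ℕ
  J_eq : ∀ p, J p = ⊥ ∨ J p = ⊤
  /-- the skew-symmetric `ℤ`-bilinear form; its radical is `φ.ker` -/
  φ : Γ →+ Γ →+ F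
  φ_skew : ∀ α β, φ α β = -φ β α
  /-- the additive homomorphisms `φ_p` -/
  φp : Fin (m + 1) × Fin 2 → Γ →+ F
  exists_ne_zero : ∀ p, ∃ α : Γ, ∃ i ∈ J p, φp p α + (i : F) ≠ 0
  rad_inf_ker : φ.ker ⊓ ⨅ p, (φp p).ker = ⊥
  exists_separating : ∀ q, φp q ≠ 0 →
    ∃ τ ∈ φ.ker, (∀ p, p ≠ q → φp p τ = 0) ∧ φp q τ ≠ 0
  σ : Fin m → Γ
  σ_mem_rad : ∀ s, σ s ∈ φ.ker
  φp_σ : ∀ s p, p ≠ (s.succ, 0) → p ≠ (s.succ, 1) → φp p (σ s) = 0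
  σ_ne_zero : ∀ s, (φp (s.succ, 0) ≠ 0 ∨ φp (s.succ, 1) ≠ 0) → σ s ≠ 0
  ε : Γ
  ε_mem_rad : ε ∈ φ.ker
  φp_ε : ∀ p, p ≠ (0, 0) → φp p ε = 0
  φp_ε_one : φp (0, 0) ε = 1

namespace TwistedDatum

noncomputable section

variable {F : Type*} [Field F] {m : ℕ} {Γ : Type*} [AddCommGroup Γ] (D : TwistedDatum F m Γ)

/-- The semigroup `𝒥 = 𝒥_1 × ⋯ × 𝒥_{2n}`. -/
def JJ : AddSubmonoid (Fin (m + 1) × Fin 2 → ℕ) := AddSubmonoid.pi Set.univ D.J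

/-- The commutative associative algebra `𝒜` with basis `x^{α,i}`, `(α,i) ∈ Γ × 𝒥`, and product
`x^{α,i} x^{β,j} = x^{α+β,i+j}`: the semigroup algebra of `Γ × 𝒥`. -/
abbrev Alg : Type _ := AddMonoidAlgebra F (Γ × D.JJ)

/-- The basis element `x^{α,i}`. -/
def x (α : Γ) (i : D.JJ) : D.Alg := AddMonoidAlgebra.single (α, i) 1

/-- The linear map out of `𝒜` with prescribed values on the basis. -/
def onBasis {M : Type*} [AddCommGroup M] [Module F M] (g : Γ → D.JJ → M) : D.Alg →ₗ[F] M :=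
  Finsupp.linearCombination F (fun a : Γ × D.JJ => g a.1 a.2) ∘ₗ
    (AddMonoidAlgebra.coeffLinearEquiv F).toLinearMap

theorem onBasis_x {M : Type*} [AddCommGroup M] [Module F M] (g : Γ → D.JJ → M) (α : Γ)
    (i : D.JJ) : D.onBasis g (D.x α i) = g α i := by
  simp [onBasis, x]

theorem hom_ext {M : Type*} [AddCommGroup M] [Module F M] {g h : D.Alg →ₗ[F] M}
    (H : ∀ α i, g (D.x α i) = h (D.x α i)) : g = h := by
  apply AddMonoidAlgebra.lhom_ext'
  rintro ⟨α, i⟩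
  ext
  exact H α i

theorem x_mul_x (α β : Γ) (i j : D.JJ) : D.x α i * D.x β j = D.x (α + β) (i + j) := by
  simp [x, AddMonoidAlgebra.single_mul_single]

/-- The multi-index `i - 1_{[p]}` (with truncated subtraction; it is only used together with the
coefficient `i_p`, which vanishes where the subtraction truncates). -/
def lower (p : Fin (m + 1) × Fin 2) (i : D.JJ) : D.JJ :=
  ⟨i.1 - Pi.single p 1, by
    have hi := i.2
    simp only [JJ, AddSubmonoid.mem_pi, Set.mem_univ, true_imp_iff] at hi ⊢
    intro q
    rcases D.J_eq q with h | h
    · have h1 := hi q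
      rw [h, AddSubmonoid.mem_bot] at h1 ⊢
      simp [h1]
    · rw [h]
      trivial⟩

/-- The derivation `∂_p`: `∂_p (x^{α,i}) = φ_p(α) x^{α,i} + i_p x^{α,i-1_{[p]}}`. -/
def der (p : Fin (m + 1) × Fin 2) : D.Alg →ₗ[F] D.Alg :=
  D.onBasis fun α i => D.φp p α • D.x α i + (i.1 p : F) • D.x α (D.lower p i)

/-- The operator `∂_p + c` for a constant `c`. -/
def derAdd (p : Fin (m + 1) × Fin 2) (c : F) : D.Alg →ₗ[F] D.Alg :=
  D.der p + c • LinearMap.id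

/-- The bilinear map with value `(φ(α,β) + f(α)) u v` for `u ∈ 𝒜_α`, `v ∈ 𝒜_β`. -/
def formMul (f : Γ →+ F) : D.Alg →ₗ[F] D.Alg →ₗ[F] D.Alg :=
  D.onBasis fun α i => D.onBasis fun β j => (D.φ α β + f α) • (D.x α i * D.x β j)

/-- The Lie bracket on `𝒜`, as a function. -/
def brFun (u w : D.Alg) : D.Alg :=
  D.x D.ε 0 * (∑ s : Fin m, D.x (D.σ s) 0 *
      (D.der (s.succ, 0) u * D.der (s.succ, 1) w - D.der (s.succ, 0) w * D.der (s.succ, 1) u)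
    + D.formMul 0 u w)
  + D.derAdd (0, 0) 1 u * D.der (0, 1) w - D.derAdd (0, 0) 1 w * D.der (0, 1) u

/-- The action of `u ∈ 𝒜` on `v ∈ 𝒜` twisted by the vector `ξ` and the homomorphism `f`. -/
def actFun (ξ : Fin (m + 1) × Fin 2 → F) (f : Γ →+ F) (u v : D.Alg) : D.Alg :=
  D.x D.ε 0 * (∑ s : Fin m, D.x (D.σ s) 0 *
      (D.der (s.succ, 0) u * D.derAdd (s.succ, 1) (ξ (s.succ, 1)) v
        - D.der (s.succ, 1) u * D.derAdd (s.succ, 0) (ξ (s.succ, 0)) v)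
    + D.formMul f u v)
  + D.derAdd (0, 0) 1 u * D.derAdd (0, 1) (ξ (0, 1)) v
  - D.der (0, 1) u * D.derAdd (0, 0) (ξ (0, 0)) v

/-- The vector `(1, 0, …, 0)`, with the entry `1` at the index `1`. -/
def ξ₀ : Fin (m + 1) × Fin 2 → F := Pi.single (0, 0) 1

/-! ### The algebraic identities behind the Jacobi identity -/

theorem alg_induction {P : D.Alg → Prop} (u : D.Alg) (hx : ∀ α i, P (D.x α i))
    (hadd : ∀ u v, P u → P v → P (u + v)) (hsmul : ∀ (c : F) u, P u → P (c • u)) : P u := by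
  induction u using AddMonoidAlgebra.induction_linear with
  | zero => simpa using hsmul 0 _ (hx 0 0)
  | add u v hu hv => exact hadd u v hu hv
  | single a r =>
    have h := hsmul r _ (hx a.1 a.2)
    simpa [x, AddMonoidAlgebra.smul_single] using h

theorem der_x (p : Fin (m + 1) × Fin 2) (α : Γ) (i : D.JJ) :
    D.der p (D.x α i) = D.φp p α • D.x α i + (i.1 p : F) • D.x α (D.lower p i) :=
  D.onBasis_x _ _ _

theorem formMul_x (f : Γ →+ F) (α β : Γ) (i j : D.JJ) :
    D.formMul f (D.x α i) (D.x β j) = (D.φ α β + f α) • (D.x α i * D.x β j) := by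
  rw [formMul, onBasis_x, onBasis_x]

theorem smul_x_lower_add (p : Fin (m + 1) × Fin 2) (α : Γ) (i j : D.JJ) :
    (i.1 p : F) • D.x α (D.lower p i + j) = (i.1 p : F) • D.x α (D.lower p (i + j)) := by
  rcases Nat.eq_zero_or_pos (i.1 p) with h | h
  · simp [h]
  · have : D.lower p i + j = D.lower p (i + j) := by
      apply Subtype.ext
      funext q
      by_cases hq : q = p
      · subst hq
        simp [lower]
        omega
      · simp [lower, hq]
    rw [this]

theorem der_mul (p : Fin (m + 1) × Fin 2) (u v : D.Alg) :
    D.der p (u * v) = D.der p u * v + u * D.der p v := by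
  induction u using D.alg_induction with
  | hadd u₁ u₂ h₁ h₂ =>
    simp only [add_mul, map_add, h₁, h₂]
    abel
  | hsmul c u h => simp only [smul_mul_assoc, map_smul, h, smul_add]
  | hx α i =>
    induction v using D.alg_induction with
    | hadd u₁ u₂ h₁ h₂ =>
      simp only [mul_add, map_add, h₁, h₂]
      abel
    | hsmul c u h => simp only [mul_smul_comm, map_smul, h, smul_add]
    | hx β j =>
      have h₁ := D.smul_x_lower_add p (α + β) i j
      have h₂ := D.smul_x_lower_add p (α + β) j i
      rw [add_comm _ i, add_comm j i] at h₂
      simp only [x_mul_x, der_x, add_mul, mul_add, smul_mul_assoc, mul_smul_comm, h₁, h₂, map_add]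
      simp only [AddSubmonoid.coe_add, Pi.add_apply, Nat.cast_add]
      module

theorem der_comm (p q : Fin (m + 1) × Fin 2) (u : D.Alg) :
    D.der p (D.der q u) = D.der q (D.der p u) := by
  induction u using D.alg_induction with
  | hadd u₁ u₂ h₁ h₂ => simp only [map_add, h₁, h₂]
  | hsmul c u h => simp only [map_smul, h]
  | hx α i =>
    by_cases hpq : p = q
    · rw [hpq]
    have h : D.lower p (D.lower q i) = D.lower q (D.lower p i) := by
      apply Subtype.ext
      simp [lower, tsub_right_comm]
    have h₁ : (D.lower q i).1 p = i.1 p := by simp [lower, hpq]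
    have h₂ : (D.lower p i).1 q = i.1 q := by simp [lower, Ne.symm hpq]
    simp only [der_x, map_add, map_smul, h, h₁, h₂]
    module

theorem derAdd_apply (p : Fin (m + 1) × Fin 2) (c : F) (u : D.Alg) :
    D.derAdd p c u = D.der p u + c • u := rfl

theorem derAdd_mul (p : Fin (m + 1) × Fin 2) (c : F) (u v : D.Alg) :
    D.derAdd p c (u * v) = D.der p u * v + u * D.derAdd p c v := by
  simp only [derAdd_apply, der_mul, mul_add, mul_smul_comm, add_assoc]

theorem derAdd_comm (p q : Fin (m + 1) × Fin 2) (c d : F) (u : D.Alg) :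
    D.derAdd p c (D.derAdd q d u) = D.derAdd q d (D.derAdd p c u) := by
  simp only [derAdd_apply, map_add, map_smul, D.der_comm p q]
  module

theorem der_x_zero (p : Fin (m + 1) × Fin 2) (α : Γ) :
    D.der p (D.x α 0) = D.φp p α • D.x α 0 := by
  simp [der_x]

theorem der_one (p : Fin (m + 1) × Fin 2) : D.der p (D.x 0 0) = 0 := by
  simp [der_x]

theorem formMul_mul_left (f : Γ →+ F) (u w v : D.Alg) :
    D.formMul f (u * w) v = u * D.formMul f w v + w * D.formMul f u v := by
  induction u using D.alg_induction with
  | hadd u₁ u₂ h₁ h₂ =>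
    simp only [add_mul, mul_add, map_add, LinearMap.add_apply, h₁, h₂]
    abel
  | hsmul c u h =>
    simp only [smul_mul_assoc, mul_smul_comm, map_smul, LinearMap.smul_apply, h, smul_add]
  | hx α i =>
    induction w using D.alg_induction with
    | hadd u₁ u₂ h₁ h₂ =>
      simp only [add_mul, mul_add, map_add, LinearMap.add_apply, h₁, h₂]
      abel
    | hsmul c u h =>
      simp only [smul_mul_assoc, mul_smul_comm, map_smul, LinearMap.smul_apply, h, smul_add]
    | hx β j =>
      induction v using D.alg_induction with
      | hadd u₁ u₂ h₁ h₂ =>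
        simp only [mul_add, map_add, h₁, h₂]
        abel
      | hsmul c u h => simp only [mul_smul_comm, map_smul, h, smul_add]
      | hx γ k =>
        rw [x_mul_x, formMul_x, formMul_x, formMul_x, ← x_mul_x]
        simp only [Algebra.smul_def, map_add, AddMonoidHom.add_apply]
        ring

theorem formMul_mul_right (f : Γ →+ F) (u w v : D.Alg) :
    D.formMul f u (w * v) = D.formMul 0 u w * v + w * D.formMul f u v := by
  induction u using D.alg_induction with
  | hadd u₁ u₂ h₁ h₂ =>
    simp only [add_mul, mul_add, map_add, LinearMap.add_apply, h₁, h₂]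
    abel
  | hsmul c u h =>
    simp only [smul_mul_assoc, mul_smul_comm, map_smul, LinearMap.smul_apply, h, smul_add]
  | hx α i =>
    induction w using D.alg_induction with
    | hadd u₁ u₂ h₁ h₂ =>
      simp only [add_mul, map_add, h₁, h₂]
      abel
    | hsmul c u h => simp only [smul_mul_assoc, map_smul, h, smul_add]
    | hx β j =>
      induction v using D.alg_induction with
      | hadd u₁ u₂ h₁ h₂ =>
        simp only [mul_add, map_add, h₁, h₂]
        abel
      | hsmul c u h => simp only [mul_smul_comm, map_smul, h, smul_add]
      | hx γ k =>
        rw [D.x_mul_x β, formMul_x, formMul_x, formMul_x, ← x_mul_x]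
        simp only [Algebra.smul_def, map_add, map_zero, AddMonoidHom.zero_apply]
        ring

theorem formMul_skew (a b : D.Alg) : D.formMul 0 a b = -D.formMul 0 b a := by
  induction a using D.alg_induction with
  | hadd u₁ u₂ h₁ h₂ =>
    simp only [map_add, LinearMap.add_apply, h₁, h₂]
    abel
  | hsmul c u h => simp only [map_smul, LinearMap.smul_apply, h, smul_neg]
  | hx α i =>
    induction b using D.alg_induction with
    | hadd u₁ u₂ h₁ h₂ =>
      simp only [map_add, LinearMap.add_apply, h₁, h₂]
      abel
    | hsmul c u h => simp only [map_smul, LinearMap.smul_apply, h, smul_neg]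
    | hx β j => simp [formMul_x, D.φ_skew α β, mul_comm (D.x α i)]

theorem formMul_jacobi (f : Γ →+ F) (u w v : D.Alg) :
    D.formMul f (D.formMul 0 u w) v
      = D.formMul f u (D.formMul f w v) - D.formMul f w (D.formMul f u v) := by
  induction u using D.alg_induction with
  | hadd u₁ u₂ h₁ h₂ =>
    simp only [map_add, LinearMap.add_apply, h₁, h₂]
    abel
  | hsmul c u h => simp only [map_smul, LinearMap.smul_apply, h, smul_sub]
  | hx α i =>
    induction w using D.alg_induction with
    | hadd u₁ u₂ h₁ h₂ =>
      simp only [map_add, LinearMap.add_apply, h₁, h₂]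
      abel
    | hsmul c u h => simp only [map_smul, LinearMap.smul_apply, h, smul_sub]
    | hx β j =>
      induction v using D.alg_induction with
      | hadd u₁ u₂ h₁ h₂ =>
        simp only [map_add, h₁, h₂]
        abel
      | hsmul c u h => simp only [map_smul, h, smul_sub]
      | hx γ k =>
        simp only [formMul_x, map_smul, LinearMap.smul_apply, x_mul_x, AddMonoidHom.zero_apply,
          map_add, AddMonoidHom.add_apply, D.φ_skew β α, add_zero]
        rw [show β + (α + γ) = α + β + γ by abel, show j + (i + k) = i + j + k by abel,
          ← add_assoc α, ← add_assoc i]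
        module

theorem derAdd_formMul (p : Fin (m + 1) × Fin 2) (c : F) (f : Γ →+ F) (u v : D.Alg) :
    D.derAdd p c (D.formMul f u v)
      = D.formMul f (D.der p u) v + D.formMul f u (D.derAdd p c v) := by
  induction u using D.alg_induction with
  | hadd u₁ u₂ h₁ h₂ =>
    simp only [map_add, LinearMap.add_apply, h₁, h₂]
    abel
  | hsmul c u h => simp only [map_smul, LinearMap.smul_apply, h, smul_add]
  | hx α i =>
    induction v using D.alg_induction with
    | hadd u₁ u₂ h₁ h₂ =>
      simp only [map_add, h₁, h₂]
      abel
    | hsmul c u h => simp only [map_smul, h, smul_add]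
    | hx β j =>
      simp only [formMul_x, derAdd_apply, map_smul, map_add, der_mul, der_x, LinearMap.add_apply,
        LinearMap.smul_apply]
      simp only [Algebra.smul_def]
      ring

theorem der_formMul (p : Fin (m + 1) × Fin 2) (f : Γ →+ F) (u v : D.Alg) :
    D.der p (D.formMul f u v) = D.formMul f (D.der p u) v + D.formMul f u (D.der p v) := by
  simpa [derAdd] using D.derAdd_formMul p 0 f u v

theorem formMul_x_left {f : Γ →+ F} (hf : D.φ.ker ≤ f.ker) {α : Γ} (hα : α ∈ D.φ.ker)
    (v : D.Alg) : D.formMul f (D.x α 0) v = 0 := by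
  have h₁ : D.φ α = 0 := hα
  have h₂ : f α = 0 := hf hα
  induction v using D.alg_induction with
  | hadd u₁ u₂ h₁ h₂ => simp only [map_add, h₁, h₂, add_zero]
  | hsmul c u h => simp only [map_smul, h, smul_zero]
  | hx β j => simp [formMul_x, h₁, h₂]

theorem formMul_x_right {α : Γ} (hα : α ∈ D.φ.ker) (u : D.Alg) :
    D.formMul 0 u (D.x α 0) = 0 := by
  have h₁ : D.φ α = 0 := hα
  induction u using D.alg_induction with
  | hadd u₁ u₂ h₁ h₂ => simp only [map_add, LinearMap.add_apply, h₁, h₂, add_zero]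
  | hsmul c u h => simp only [map_smul, LinearMap.smul_apply, h, smul_zero]
  | hx β j => simp [formMul_x, D.φ_skew β α, h₁]

/-- The exponents `-ε, σ_3, σ_5, …`. -/
def wt : Fin (m + 1) → Γ := Fin.cons (-D.ε) D.σ

theorem wt_mem_rad (k : Fin (m + 1)) : D.wt k ∈ D.φ.ker := by
  refine Fin.cases ?_ (fun s => ?_) k
  · simpa [wt] using D.ε_mem_rad
  · simpa [wt] using D.σ_mem_rad s

theorem φp_wt (k l : Fin (m + 1)) (h : l ≠ k) (i : Fin 2) : D.φp (l, i) (D.wt k) = 0 := by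
  revert h
  refine Fin.cases ?_ (fun s => ?_) k
  · intro h
    simp only [wt, Fin.cons_zero, map_neg, neg_eq_zero]
    exact D.φp_ε _ (by simp [h])
  · intro h
    simp only [wt, Fin.cons_succ]
    exact D.φp_σ _ _ (by simp [h]) (by simp [h])

/-- The `k`-th elementary bracket. -/
def blk (ξ : Fin (m + 1) × Fin 2 → F) (k : Fin (m + 1)) (u v : D.Alg) : D.Alg :=
  D.x (D.wt k) 0 * (D.der (k, 0) u * D.derAdd (k, 1) (ξ (k, 1)) v
    - D.der (k, 1) u * D.derAdd (k, 0) (ξ (k, 0)) v)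

/-- The untwisted form of the action: `u` acts on `v` as `x^ε u` does here. -/
def poi (ξ : Fin (m + 1) × Fin 2 → F) (f : Γ →+ F) (u v : D.Alg) : D.Alg :=
  ∑ k, D.blk ξ k u v + D.formMul f u v

theorem derAdd_zero (p : Fin (m + 1) × Fin 2) (u : D.Alg) : D.derAdd p 0 u = D.der p u := by
  simp [derAdd]

theorem blk_blk_self (ξ : Fin (m + 1) × Fin 2 → F) (k : Fin (m + 1)) (u w v : D.Alg) :
    D.blk ξ k (D.blk 0 k u w) v - D.blk ξ k u (D.blk ξ k w v)
      + D.blk ξ k w (D.blk ξ k u v) = 0 := by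
  simp only [blk, Pi.zero_apply, derAdd_zero, der_mul, derAdd_mul, map_sub, der_x_zero,
    D.der_comm (k, 1) (k, 0), D.derAdd_comm (k, 1) (k, 0), Algebra.smul_def]
  ring

theorem blk_blk_ne (ξ : Fin (m + 1) × Fin 2 → F) (k l : Fin (m + 1)) (h : k ≠ l)
    (u w v : D.Alg) :
    (D.blk ξ k (D.blk 0 l u w) v - D.blk ξ k u (D.blk ξ l w v) + D.blk ξ k w (D.blk ξ l u v))
    + (D.blk ξ l (D.blk 0 k u w) v - D.blk ξ l u (D.blk ξ k w v)
      + D.blk ξ l w (D.blk ξ k u v)) = 0 := by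
  simp only [blk, Pi.zero_apply, derAdd_zero, der_mul, derAdd_mul, map_sub, der_x_zero,
    D.φp_wt k l h.symm, D.φp_wt l k h, zero_smul,
    D.der_comm (l, 0) (k, 0), D.der_comm (l, 0) (k, 1), D.der_comm (l, 1) (k, 0),
    D.der_comm (l, 1) (k, 1), D.derAdd_comm (l, 0) (k, 0), D.derAdd_comm (l, 0) (k, 1),
    D.derAdd_comm (l, 1) (k, 0), D.derAdd_comm (l, 1) (k, 1)]
  ring

theorem blk_formMul (ξ : Fin (m + 1) × Fin 2 → F) {f : Γ →+ F} (hf : D.φ.ker ≤ f.ker)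
    (k : Fin (m + 1)) (u w v : D.Alg) :
    D.blk ξ k (D.formMul 0 u w) v + D.formMul f (D.blk 0 k u w) v
      - D.blk ξ k u (D.formMul f w v) - D.formMul f u (D.blk ξ k w v)
      + D.blk ξ k w (D.formMul f u v) + D.formMul f w (D.blk ξ k u v) = 0 := by
  simp only [blk, Pi.zero_apply, derAdd_zero, der_formMul, derAdd_formMul, formMul_mul_left,
    formMul_mul_right, map_sub, LinearMap.sub_apply, D.formMul_x_left hf (D.wt_mem_rad k),
    D.formMul_x_right (D.wt_mem_rad k), D.formMul_skew w (D.der (k, 0) u),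
    D.formMul_skew w (D.der (k, 1) u)]
  ring

theorem blk_add_left (ξ : Fin (m + 1) × Fin 2 → F) (k : Fin (m + 1)) (u u' v : D.Alg) :
    D.blk ξ k (u + u') v = D.blk ξ k u v + D.blk ξ k u' v := by
  simp only [blk, map_add]
  ring

theorem blk_add_right (ξ : Fin (m + 1) × Fin 2 → F) (k : Fin (m + 1)) (u v v' : D.Alg) :
    D.blk ξ k u (v + v') = D.blk ξ k u v + D.blk ξ k u v' := by
  simp only [blk, map_add]
  ring

theorem blk_sum_left {ι : Type*} (ξ : Fin (m + 1) × Fin 2 → F) (k : Fin (m + 1))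
    (t : Finset ι) (g : ι → D.Alg) (v : D.Alg) :
    D.blk ξ k (∑ l ∈ t, g l) v = ∑ l ∈ t, D.blk ξ k (g l) v := by
  simp only [blk, map_sum, Finset.sum_mul, Finset.mul_sum, ← Finset.sum_sub_distrib]

theorem blk_sum_right {ι : Type*} (ξ : Fin (m + 1) × Fin 2 → F) (k : Fin (m + 1))
    (t : Finset ι) (g : ι → D.Alg) (u : D.Alg) :
    D.blk ξ k u (∑ l ∈ t, g l) = ∑ l ∈ t, D.blk ξ k u (g l) := by
  simp only [blk, map_sum, Finset.mul_sum, ← Finset.sum_sub_distrib]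

theorem poi_jacobi (ξ : Fin (m + 1) × Fin 2 → F) {f : Γ →+ F} (hf : D.φ.ker ≤ f.ker)
    (u w v : D.Alg) :
    D.poi ξ f (D.poi 0 0 u w) v = D.poi ξ f u (D.poi ξ f w v) - D.poi ξ f w (D.poi ξ f u v) := by
  have h₁ : ∑ q : Fin (m + 1) × Fin (m + 1), (D.blk ξ q.1 (D.blk 0 q.2 u w) v
      - D.blk ξ q.1 u (D.blk ξ q.2 w v) + D.blk ξ q.1 w (D.blk ξ q.2 u v)) = 0 := by
    refine Finset.sum_involution (fun q _ => q.swap) ?_ ?_ ?_ ?_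
    · rintro ⟨k, l⟩ _
      by_cases h : k = l
      · subst h
        simp only [Prod.swap_prod_mk, blk_blk_self, add_zero]
      · exact D.blk_blk_ne ξ k l h u w v
    · rintro ⟨k, l⟩ _ h₂ h₃
      have h : l = k := congrArg Prod.fst h₃
      subst h
      exact h₂ (D.blk_blk_self ξ l u w v)
    · intros
      simp
    · intros
      simp
  have h₂ := Finset.sum_congr rfl fun (k : Fin (m + 1)) (_ : k ∈ Finset.univ) =>
    D.blk_formMul ξ hf k u w v
  have h₃ := D.formMul_jacobi f u w v
  rw [Fintype.sum_prod_type] at h₁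
  simp only [Finset.sum_add_distrib, Finset.sum_sub_distrib, Finset.sum_const_zero] at h₁ h₂
  simp only [poi, blk_add_left, blk_add_right, blk_sum_left, blk_sum_right, map_add, map_sum,
    LinearMap.add_apply, LinearMap.sum_apply, Finset.sum_add_distrib]
  linear_combination h₁ + h₂ + h₃

theorem x_neg_mul_x (α : Γ) : D.x (-α) 0 * D.x α 0 = 1 := by
  rw [x_mul_x, neg_add_cancel, add_zero]
  rfl

theorem x_mul_x_neg (α : Γ) : D.x α 0 * D.x (-α) 0 = 1 := by
  rw [mul_comm, x_neg_mul_x]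

theorem actFun_eq_poi (ξ : Fin (m + 1) × Fin 2 → F) {f : Γ →+ F} (hf : D.φ.ker ≤ f.ker)
    (u v : D.Alg) : D.actFun ξ f u v = D.poi ξ f (D.x D.ε 0 * u) v := by
  have hs : ∀ (s : Fin m) (i : Fin 2), D.φp (s.succ, i) D.ε = 0 :=
    fun s i => D.φp_ε _ (by simp)
  have h0 : D.φp (0, 1) D.ε = 0 := D.φp_ε _ (by simp)
  have hx := D.x_neg_mul_x D.ε
  simp only [poi, Fin.sum_univ_succ, blk, wt, Fin.cons_zero, Fin.cons_succ, der_mul, der_x_zero,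
    formMul_mul_left, D.formMul_x_left hf D.ε_mem_rad, hs, h0, D.φp_ε_one, zero_smul, one_smul,
    zero_mul, zero_add, mul_zero, add_zero, actFun, mul_add, Finset.mul_sum]
  have h : ∀ s : Fin m, D.x (D.σ s) 0 *
      (D.x D.ε 0 * D.der (s.succ, 0) u * D.derAdd (s.succ, 1) (ξ (s.succ, 1)) v
        - D.x D.ε 0 * D.der (s.succ, 1) u * D.derAdd (s.succ, 0) (ξ (s.succ, 0)) v)
      = D.x D.ε 0 * (D.x (D.σ s) 0 *
      (D.der (s.succ, 0) u * D.derAdd (s.succ, 1) (ξ (s.succ, 1)) v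
        - D.der (s.succ, 1) u * D.derAdd (s.succ, 0) (ξ (s.succ, 0)) v)) := fun s => by ring
  simp only [h, derAdd_apply D (0, 0) 1 u, one_smul]
  linear_combination (-(u + D.der (0, 0) u) * D.derAdd (0, 1) (ξ (0, 1)) v
    + D.der (0, 1) u * D.derAdd (0, 0) (ξ (0, 0)) v) * hx

theorem brFun_eq_actFun (u w : D.Alg) : D.brFun u w = D.actFun ξ₀ 0 u w := by
  have h : ∀ (s : Fin m) (i : Fin 2), (ξ₀ : Fin (m + 1) × Fin 2 → F) (s.succ, i) = 0 := by
    intro s i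
    simp [ξ₀]
  have h₁ : (ξ₀ : Fin (m + 1) × Fin 2 → F) (0, 1) = 0 := by simp [ξ₀]
  have h₀ : (ξ₀ : Fin (m + 1) × Fin 2 → F) (0, 0) = 1 := by simp [ξ₀]
  simp only [brFun, actFun, h, h₁, h₀, derAdd_zero, mul_comm (D.derAdd (0, 0) 1 w),
    mul_comm (D.der (_, 0) w)]

theorem x_mul_brFun (u w : D.Alg) :
    D.x D.ε 0 * D.brFun u w = D.poi 0 0 (D.x D.ε 0 * u) (D.x D.ε 0 * w) := by
  have hs : ∀ (s : Fin m) (i : Fin 2), D.φp (s.succ, i) D.ε = 0 :=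
    fun s i => D.φp_ε _ (by simp)
  have h0 : D.φp (0, 1) D.ε = 0 := D.φp_ε _ (by simp)
  rw [brFun_eq_actFun, actFun_eq_poi D _ (by simp)]
  have e : ∀ (p : Fin (m + 1) × Fin 2),
      D.der p (D.x D.ε 0 * w) = D.x D.ε 0 * D.derAdd p (ξ₀ p) w := by
    intro p
    rw [der_mul, der_x_zero, derAdd_apply]
    by_cases hp : p = (0, 0)
    · subst hp
      simp only [D.φp_ε_one, ξ₀, Pi.single_eq_same, one_smul]
      ring
    · simp [D.φp_ε p hp, ξ₀, hp]
  simp only [poi, blk, Pi.zero_apply, derAdd_zero, e, formMul_mul_right,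
    D.formMul_x_right D.ε_mem_rad, mul_add, Finset.mul_sum]
  simp only [zero_mul, zero_add]
  congr 1
  exact Finset.sum_congr rfl fun k _ => by ring

theorem actFun_brFun (ξ : Fin (m + 1) × Fin 2 → F) {f : Γ →+ F} (hf : D.φ.ker ≤ f.ker)
    (u w v : D.Alg) : D.actFun ξ f (D.brFun u w) v
      = D.actFun ξ f u (D.actFun ξ f w v) - D.actFun ξ f w (D.actFun ξ f u v) := by
  simp only [D.actFun_eq_poi ξ hf, x_mul_brFun]
  exact D.poi_jacobi ξ hf _ _ _

theorem blk_smul_left (ξ : Fin (m + 1) × Fin 2 → F) (k : Fin (m + 1)) (c : F) (u v : D.Alg) :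
    D.blk ξ k (c • u) v = c • D.blk ξ k u v := by
  simp only [blk, map_smul, smul_mul_assoc, ← smul_sub, mul_smul_comm]

theorem blk_smul_right (ξ : Fin (m + 1) × Fin 2 → F) (k : Fin (m + 1)) (c : F) (u v : D.Alg) :
    D.blk ξ k u (c • v) = c • D.blk ξ k u v := by
  simp only [blk, map_smul, mul_smul_comm, ← smul_sub]

/-- The twisted action `actFun` as a bilinear map. -/
def act (ξ : Fin (m + 1) × Fin 2 → F) (f : Γ →+ F) (hf : D.φ.ker ≤ f.ker) :
    D.Alg →ₗ[F] D.Alg →ₗ[F] D.Alg :=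
  LinearMap.mk₂ F (D.actFun ξ f)
    (fun u u' v => by
      simp only [D.actFun_eq_poi ξ hf, poi, mul_add, blk_add_left, map_add, LinearMap.add_apply,
        Finset.sum_add_distrib]
      abel)
    (fun c u v => by
      simp only [D.actFun_eq_poi ξ hf, poi, mul_smul_comm, blk_smul_left, map_smul,
        LinearMap.smul_apply, Finset.smul_sum, smul_add])
    (fun u v v' => by
      simp only [D.actFun_eq_poi ξ hf, poi, blk_add_right, map_add, Finset.sum_add_distrib]
      abel)
    (fun c u v => by
      simp only [D.actFun_eq_poi ξ hf, poi, blk_smul_right, map_smul, Finset.smul_sum, smul_add])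

theorem act_apply (ξ : Fin (m + 1) × Fin 2 → F) (f : Γ →+ F) (hf : D.φ.ker ≤ f.ker)
    (u v : D.Alg) : D.act ξ f hf u v = D.actFun ξ f u v := rfl

theorem brFun_eq_act (u w : D.Alg) : D.brFun u w = D.act ξ₀ 0 (by simp) u w :=
  D.brFun_eq_actFun u w

theorem actFun_x_neg_ε (ξ : Fin (m + 1) × Fin 2 → F) {f : Γ →+ F} (hf : D.φ.ker ≤ f.ker)
    (v : D.Alg) : D.actFun ξ f (D.x (-D.ε) 0) v = 0 := by
  rw [D.actFun_eq_poi ξ hf, x_mul_x_neg]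
  have h₁ : D.formMul f (D.x 0 0) v = 0 := D.formMul_x_left hf (zero_mem _) v
  change D.poi ξ f (D.x 0 0) v = 0
  simp [poi, blk, der_one, h₁]

theorem brFun_self [CharZero F] (u : D.Alg) : D.brFun u u = 0 := by
  have h : D.formMul 0 u u = 0 := by
    have h₁ : (2 : F) • D.formMul 0 u u = 0 := by
      rw [two_smul]
      exact add_eq_zero_iff_eq_neg.2 (D.formMul_skew u u)
    exact (smul_eq_zero.1 h₁).resolve_left two_ne_zero
  simp only [brFun, sub_self, mul_zero, Finset.sum_const_zero, h, add_zero, zero_add]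

/-! ### The Lie algebras -/

/-- The space `𝒜`, regarded as a Lie algebra under the bracket `brFun`. -/
def LieA : Type _ := D.Alg

instance : AddCommGroup D.LieA := inferInstanceAs (AddCommGroup D.Alg)

instance : Module F D.LieA := inferInstanceAs (Module F D.Alg)

/-- The identity map from the algebra `𝒜` to the Lie algebra `𝒜`. -/
def toLieA : D.Alg ≃ₗ[F] D.LieA := LinearEquiv.refl F D.Alg

instance : Bracket D.LieA D.LieA :=
  ⟨fun u w => D.toLieA (D.brFun (D.toLieA.symm u) (D.toLieA.symm w))⟩

theorem lieA_def (u w : D.LieA) :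
    ⁅u, w⁆ = D.toLieA (D.brFun (D.toLieA.symm u) (D.toLieA.symm w)) := rfl

variable [CharZero F]

instance : LieRing D.LieA where
  add_lie u v w := by simp only [lieA_def, brFun_eq_act, map_add, LinearMap.add_apply]
  lie_add u v w := by simp only [lieA_def, brFun_eq_act, map_add]
  lie_self u := by rw [lieA_def, brFun_self, map_zero]
  leibniz_lie u v w := by
    have h := D.actFun_brFun ξ₀ (f := 0) (by simp) (D.toLieA.symm u) (D.toLieA.symm v)
      (D.toLieA.symm w)
    simp only [← brFun_eq_actFun] at h
    simp only [lieA_def, LinearEquiv.symm_apply_apply, ← map_add, h, sub_add_cancel]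

instance : LieAlgebra F D.LieA where
  lie_smul c u w := by simp only [lieA_def, brFun_eq_act, map_smul]

/-- The central line `F x^{-ε,0}` of the Lie algebra `𝒜`. -/
def line : LieIdeal F D.LieA :=
  { (F ∙ D.toLieA (D.x (-D.ε) 0) : Submodule F D.LieA) with
    lie_mem := by
      intro u w hw
      obtain ⟨c, rfl⟩ := Submodule.mem_span_singleton.1 hw
      have h : ⁅u, c • D.toLieA (D.x (-D.ε) 0)⁆ = 0 := by
        rw [lie_smul, ← lie_skew, lieA_def, LinearEquiv.symm_apply_apply, brFun_eq_actFun,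
          D.actFun_x_neg_ε ξ₀ (by simp), map_zero, neg_zero, smul_zero]
      rw [h]
      exact Submodule.zero_mem _ }

/-- The twisted Hamiltonian Lie algebra `ℋ = 𝒜 / F x^{-ε,0}`. -/
abbrev H : Type _ := D.LieA ⧸ D.line

/-- The class `ū = u + F x^{-ε,0}` of `u ∈ 𝒜` in `ℋ`. -/
def bar (u : D.LieA) : D.H := LieSubmodule.Quotient.mk u

/-! ### The modules -/

/-- The space `𝒜`, regarded as the `ℋ`-module `𝒜_{ξ,f}`. -/
def Mod (_ξ : Fin (m + 1) × Fin 2 → F) (f : Γ →+ F) (_hf : D.φ.ker ≤ f.ker) : Type _ := D.Alg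

variable (ξ : Fin (m + 1) × Fin 2 → F) (f : Γ →+ F) (hf : D.φ.ker ≤ f.ker)

instance : AddCommGroup (D.Mod ξ f hf) := inferInstanceAs (AddCommGroup D.Alg)

instance : Module F (D.Mod ξ f hf) := inferInstanceAs (Module F D.Alg)

/-- The identity map from `𝒜` to `𝒜_{ξ,f}`. -/
def toMod : D.Alg ≃ₗ[F] D.Mod ξ f hf := LinearEquiv.refl F D.Alg

/-- The map `ū ↦ (v ↦ ū.v)`, where `ū.v` is given by `actFun ξ f u v`. -/
def rho : D.H →ₗ[F] D.Alg →ₗ[F] D.Alg :=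
  Submodule.liftQ D.line.toSubmodule (D.act ξ f hf ∘ₗ D.toLieA.symm.toLinearMap) <| by
    change (F ∙ D.toLieA (D.x (-D.ε) 0) : Submodule F D.LieA) ≤ _
    rw [Submodule.span_singleton_le_iff_mem, LinearMap.mem_ker]
    refine LinearMap.ext fun v => ?_
    exact D.actFun_x_neg_ε ξ hf v

instance : Bracket D.H (D.Mod ξ f hf) :=
  ⟨fun h v => D.toMod ξ f hf (D.rho ξ f hf h ((D.toMod ξ f hf).symm v))⟩

theorem lieMod_def (h : D.H) (v : D.Mod ξ f hf) :
    ⁅h, v⁆ = D.toMod ξ f hf (D.rho ξ f hf h ((D.toMod ξ f hf).symm v)) := rfl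

/-- The defining formula of the action of `ℋ` on `𝒜_{ξ,f}`. -/
theorem bar_lie (u v : D.Alg) :
    ⁅D.bar (D.toLieA u), D.toMod ξ f hf v⁆ = D.toMod ξ f hf (D.actFun ξ f u v) := rfl

instance : LieRingModule D.H (D.Mod ξ f hf) where
  add_lie g h v := by simp only [lieMod_def, map_add, LinearMap.add_apply]
  lie_add g v w := by simp only [lieMod_def, map_add]
  leibniz_lie g h v := by
    obtain ⟨u, rfl⟩ := Submodule.Quotient.mk_surjective _ g
    obtain ⟨w, rfl⟩ := Submodule.Quotient.mk_surjective _ h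
    have h := D.actFun_brFun ξ hf (D.toLieA.symm u) (D.toLieA.symm w) ((D.toMod ξ f hf).symm v)
    exact (eq_sub_iff_add_eq.1 h).symm

instance : LieModule F D.H (D.Mod ξ f hf) where
  smul_lie c h v := by simp only [lieMod_def, map_smul, LinearMap.smul_apply]
  lie_smul c h v := by simp only [lieMod_def, map_smul]

end

end TwistedDatum

/-! The action of `u` in the twisted module is `P_u`-type: replacing `u` by `x^ε u` turns `actFun`
into `poi`, so a submodule `N` is a subspace stable under all operators `P_u = poi ξ f u`. Write
`{u,w} = poi 0 0 u w`. This is a Poisson bracket, `P` is a derivation in its index, `P_{uw} = u P_w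
+ w P_u`, and each `P_u` is a first-order operator over `{u,·}`, that is, `P_u(wv) = {u,w}v + w P_u
v`.

Irreducibility rests on a passage from Lie submodules to associative ideals. Combining products of
these operators shows that, whenever `{s,θ}` is a unit for some `s`, the operator `P_θ` sends the
whole ideal `K` generated by the values `P_t v`, `v ∈ N`, back into `N`
(`poi_mul_poi_mem_of_isUnit`). The ideal `K` is itself stable under every `P_u`, and a nonzero ideal
with this stability is all of `𝒜` (`eq_top_of_poi_stable`), by separating weights and lowering
degrees. If `K = 0` with `N ≠ 0`, some nonzero `v` is killed by every `P_u`, and a weight `β` of `v`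
yields the excluded `μ = -β` (`poiIdeal_ne_bot`). Hence `N` contains `P_θ(𝒜)` for every such `θ`,
and these images span `𝒜` unless the excluded `μ` exists (`eq_top_of_poi_mem`).

When `μ` exists, multiplication by `x^μ` conjugates the twist away. Since the twist `ξ₀` is the one
coming from `ε`, multiplication by `x^{-ε} x^μ` is the required isomorphism. -/

namespace TwistedDatum

variable {F : Type*} [Field F] {m : ℕ} {Γ : Type*} [AddCommGroup Γ] (D : TwistedDatum F m Γ)

/-! ### The Poisson calculus of the operators `poi ξ f u` -/

section Calculus

variable (ξ : Fin (m + 1) × Fin 2 → F) (f : Γ →+ F)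

theorem poi_add_left (u u' v : D.Alg) :
    D.poi ξ f (u + u') v = D.poi ξ f u v + D.poi ξ f u' v := by
  simp only [poi, blk_add_left, map_add, LinearMap.add_apply, Finset.sum_add_distrib]
  abel

theorem poi_add_right (u v v' : D.Alg) :
    D.poi ξ f u (v + v') = D.poi ξ f u v + D.poi ξ f u v' := by
  simp only [poi, blk_add_right, map_add, Finset.sum_add_distrib]
  abel

theorem poi_smul_right (c : F) (u v : D.Alg) :
    D.poi ξ f u (c • v) = c • D.poi ξ f u v := by
  simp only [poi, blk_smul_right, map_smul, Finset.smul_sum, smul_add]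

theorem poi_zero_right (u : D.Alg) : D.poi ξ f u 0 = 0 := by
  simpa using D.poi_smul_right ξ f 0 u 0

theorem poi_mul_left (u w v : D.Alg) :
    D.poi ξ f (u * w) v = u * D.poi ξ f w v + w * D.poi ξ f u v := by
  have h : ∀ k, D.blk ξ k (u * w) v = u * D.blk ξ k w v + w * D.blk ξ k u v := by
    intro k
    simp only [blk, der_mul]
    ring
  simp only [poi, h, formMul_mul_left, Finset.sum_add_distrib, mul_add, Finset.mul_sum]
  abel

/-- The twist `ξ, f` sits only in the zeroth-order part of `P_u`, so differentiating the factor `w`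
produces the untwisted bracket. -/
theorem poi_mul_right (u w v : D.Alg) :
    D.poi ξ f u (w * v) = D.poi 0 0 u w * v + w * D.poi ξ f u v := by
  have h : ∀ k, D.blk ξ k u (w * v) = D.blk 0 k u w * v + w * D.blk ξ k u v := by
    intro k
    simp only [blk, derAdd_mul, Pi.zero_apply, derAdd_zero]
    ring
  simp only [poi, h, formMul_mul_right, Finset.sum_add_distrib, mul_add, add_mul, Finset.mul_sum,
    Finset.sum_mul]
  abel

theorem poi_zero_skew (u w : D.Alg) : D.poi 0 0 u w = -D.poi 0 0 w u := by
  have h : ∀ k, D.blk 0 k u w = -D.blk 0 k w u := by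
    intro k
    simp only [blk, Pi.zero_apply, derAdd_zero]
    ring
  simp only [poi, h, D.formMul_skew u w, Finset.sum_neg_distrib, neg_add]

end Calculus

section Stable

variable [CharZero F] {ξ : Fin (m + 1) × Fin 2 → F} {f : Γ →+ F} {N : Submodule F D.Alg}

theorem mem_of_add_self_mem {v : D.Alg} (h : v + v ∈ N) : v ∈ N := by
  rw [← two_smul F] at h
  exact (N.smul_mem_iff (two_ne_zero)).1 h

/-- By the two Leibniz rules, `2 P_t(a P_t v) = 2 P_{ta} P_t v - P_a P_{t²} v`: the terms `t P_a P_t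
v` cancel. -/
theorem poi_mul_poi_mem (hN : ∀ u, ∀ v ∈ N, D.poi ξ f u v ∈ N) (t a : D.Alg) {v : D.Alg}
    (hv : v ∈ N) : D.poi ξ f t (a * D.poi ξ f t v) ∈ N := by
  apply D.mem_of_add_self_mem
  have h₁ := hN (t * a) _ (hN t _ hv)
  have h₂ := hN a _ (hN (t * t) _ hv)
  have h := N.sub_mem (N.add_mem h₁ h₁) h₂
  convert h using 1
  simp only [poi_mul_left, poi_mul_right, poi_add_right, D.poi_zero_skew a t]
  ring

/-- With `X = b P_s v`, one has `2 P_θ({s,θ} X) = 2 P_θ P_s(θX) - P_{θ²} P_s X`, because `{θ,θ} =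
0`; both terms on the right are in `N` by `poi_mul_poi_mem`. -/
theorem poi_poi_mul_poi_mem (hN : ∀ u, ∀ v ∈ N, D.poi ξ f u v ∈ N) (θ s b : D.Alg) {v : D.Alg}
    (hv : v ∈ N) : D.poi ξ f θ (D.poi 0 0 s θ * (b * D.poi ξ f s v)) ∈ N := by
  apply D.mem_of_add_self_mem
  have h₁ := hN (θ * θ) _ (D.poi_mul_poi_mem hN s b hv)
  have h₂ := hN θ _ (D.poi_mul_poi_mem hN s (θ * b) hv)
  have h₀ : D.poi 0 0 θ θ = 0 := by
    have h := D.poi_zero_skew θ θ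
    rw [eq_neg_iff_add_eq_zero, ← two_smul F] at h
    exact (smul_eq_zero.1 h).resolve_left two_ne_zero
  have h := N.sub_mem (N.add_mem h₂ h₂) h₁
  convert h using 1
  rw [mul_assoc, D.poi_mul_right ξ f s θ, D.poi_add_right, D.poi_mul_left ξ f θ θ,
    D.poi_mul_right ξ f θ θ, h₀]
  ring

/-- If the bracket of some element with `θ` is a unit, then the operators
`v ↦ poi θ (u * poi t v)` preserve every submodule. -/
theorem poi_mul_poi_mem_of_isUnit (hN : ∀ u, ∀ v ∈ N, D.poi ξ f u v ∈ N) {θ s : D.Alg}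
    (hs : IsUnit (D.poi 0 0 s θ)) (u t : D.Alg) {v : D.Alg} (hv : v ∈ N) :
    D.poi ξ f θ (u * D.poi ξ f t v) ∈ N := by
  obtain ⟨z, hz⟩ := hs.exists_right_inv
  have key : ∀ w, D.poi ξ f θ (w * D.poi ξ f s v) ∈ N := by
    intro w
    have h := D.poi_poi_mul_poi_mem hN θ s (z * w) hv
    rwa [← mul_assoc, ← mul_assoc, hz, one_mul] at h
  -- Polarization in `s`. With `z` inverse to `{s,θ}`, expanding at `s + t` gives four terms; three
  -- are already known to lie in `N`, and the fourth is the one wanted.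
  have h₁ := D.poi_poi_mul_poi_mem hN θ (s + t) (z * u) hv
  have h₂ := D.poi_poi_mul_poi_mem hN θ t (z * u) hv
  have h₃ := key u
  have h₄ := key (D.poi 0 0 t θ * (z * u))
  have e : D.poi 0 0 (s + t) θ * (z * u * D.poi ξ f (s + t) v)
      = u * D.poi ξ f s v + u * D.poi ξ f t v + D.poi 0 0 t θ * (z * u) * D.poi ξ f s v
        + D.poi 0 0 t θ * (z * u * D.poi ξ f t v) := by
    simp only [poi_add_left]
    linear_combination (u * D.poi ξ f s v + u * D.poi ξ f t v) * hz
  rw [e] at h₁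
  simp only [poi_add_right] at h₁
  have h := N.sub_mem (N.sub_mem (N.sub_mem h₁ h₂) h₃) h₄
  convert h using 1
  ring

end Stable

/-- The ideal of `𝒜` generated by the values of the operators `poi ξ f t` on `N`. -/
noncomputable def poiIdeal (ξ : Fin (m + 1) × Fin 2 → F) (f : Γ →+ F) (N : Submodule F D.Alg) : Ideal D.Alg :=
  Ideal.span {w | ∃ t, ∃ v ∈ N, w = D.poi ξ f t v}

/-- Generators go to generators because `N` is stable; the rule for `P_u(aw)` extends this to their
multiples. -/
theorem poi_mem_poiIdeal {ξ : Fin (m + 1) × Fin 2 → F} {f : Γ →+ F} {N : Submodule F D.Alg}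
    (hN : ∀ u, ∀ v ∈ N, D.poi ξ f u v ∈ N) (u : D.Alg) {w : D.Alg}
    (hw : w ∈ D.poiIdeal ξ f N) : D.poi ξ f u w ∈ D.poiIdeal ξ f N := by
  induction hw using Submodule.span_induction with
  | mem w h =>
    obtain ⟨t, v, hv, rfl⟩ := h
    exact Ideal.subset_span ⟨u, _, hN t v hv, rfl⟩
  | zero =>
    rw [poi_zero_right]
    exact Ideal.zero_mem _
  | add w w' _ _ h h' =>
    rw [poi_add_right]
    exact Ideal.add_mem _ h h'
  | smul a w hw h =>
    rw [smul_eq_mul, poi_mul_right]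
    exact Ideal.add_mem _ (Ideal.mul_mem_left _ _ hw) (Ideal.mul_mem_left _ _ h)

theorem poi_mem_of_poiIdeal_eq_top [CharZero F] {ξ : Fin (m + 1) × Fin 2 → F} {f : Γ →+ F}
    {N : Submodule F D.Alg} (hN : ∀ u, ∀ v ∈ N, D.poi ξ f u v ∈ N)
    (hK : D.poiIdeal ξ f N = ⊤) {θ s : D.Alg} (hs : IsUnit (D.poi 0 0 s θ)) (w : D.Alg) :
    D.poi ξ f θ w ∈ N := by
  have hw : w ∈ D.poiIdeal ξ f N := hK ▸ Submodule.mem_top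
  -- `N` is only a subspace, so the induction over the ideal must carry an arbitrary multiplier `a`.
  have key : ∀ a, D.poi ξ f θ (a * w) ∈ N := by
    induction hw using Submodule.span_induction with
    | mem w h =>
      obtain ⟨t, v, hv, rfl⟩ := h
      exact fun a => D.poi_mul_poi_mem_of_isUnit hN hs a t hv
    | zero =>
      intro a
      rw [mul_zero, poi_zero_right]
      exact N.zero_mem
    | add w w' _ _ h h' =>
      intro a
      rw [mul_add, poi_add_right]
      exact N.add_mem (h a) (h' a)
    | smul b w _ h =>
      intro a
      rw [smul_eq_mul, ← mul_assoc]
      exact h _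
  simpa using key 1

/-! ### Elements acting by a single derivation -/

section Coordinates

/-- There is an element whose only nonzero partial derivative is the one in the direction `p`,
where it is a scalar multiple of a group-like element. -/
theorem exists_coordinate (p : Fin (m + 1) × Fin 2) : ∃ (U : D.Alg) (c : F) (b : Γ), c ≠ 0 ∧
    (∀ q, q ≠ p → D.φp q b = 0) ∧ D.der p U = c • D.x b 0 ∧ (∀ q, q ≠ p → D.der q U = 0) ∧
    ∀ f : Γ →+ F, D.φ.ker ≤ f.ker → ∀ v, D.formMul f U v = 0 := by
  by_cases hp : D.φp p = 0
  -- If `φ_p = 0`, nondegeneracy forces `𝒥_p = ℕ` and the polynomial variable serves; otherwise a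
  -- separating `x^τ` does.
  · have hJ : D.J p = ⊤ := by
      refine (D.J_eq p).resolve_left fun h => ?_
      obtain ⟨α, i, hi, h'⟩ := D.exists_ne_zero p
      rw [h, AddSubmonoid.mem_bot] at hi
      simp [hp, hi] at h'
    have hmem : (Pi.single p 1 : Fin (m + 1) × Fin 2 → ℕ) ∈ D.JJ := by
      simp only [JJ, AddSubmonoid.mem_pi, Set.mem_univ, true_imp_iff]
      intro q
      by_cases hq : q = p
      · subst hq
        rw [hJ]
        trivial
      · simp [hq]
    refine ⟨D.x 0 ⟨Pi.single p 1, hmem⟩, 1, 0, one_ne_zero, by simp, ?_, ?_, ?_⟩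
    · have : D.lower p ⟨Pi.single p 1, hmem⟩ = 0 := by
        apply Subtype.ext
        simp [lower]
      simp [der_x, this]
    · intro q hq
      simp [der_x, hq]
    · intro f hf v
      induction v using D.alg_induction with
      | hadd u₁ u₂ h₁ h₂ => simp only [map_add, h₁, h₂, add_zero]
      | hsmul c u h => simp only [map_smul, h, smul_zero]
      | hx β j => simp [formMul_x]
  · obtain ⟨τ, hτ, hτ', hp'⟩ := D.exists_separating p hp
    refine ⟨D.x τ 0, D.φp p τ, τ, hp', hτ', D.der_x_zero p τ, ?_, ?_⟩
    · intro q hq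
      rw [der_x_zero, hτ' q hq, zero_smul]
    · exact fun f hf v => D.formMul_x_left hf hτ v

/-- `U` is the coordinate conjugate to `(k,i)`, so only half of the block `k` survives. The value of
`φ_{(k,i)}` at `b` later locates the monomials missed by the image of `P_U`; the derivative of `U`
supplies an element whose bracket with `U` is a unit. -/
theorem exists_poi_eq_derAdd (k : Fin (m + 1)) (i : Fin 2) : ∃ (U : D.Alg) (c : F) (b : Γ), c ≠ 0 ∧
    D.φp (k, i) b = D.φp (k, i) (D.wt k) ∧ (∃ (c' : F) (b' : Γ), c' ≠ 0 ∧ D.der (k, 1 - i) U = c' • D.x b' 0) ∧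
    ∀ (ξ : Fin (m + 1) × Fin 2 → F) (f : Γ →+ F), D.φ.ker ≤ f.ker → ∀ v,
      D.poi ξ f U v = c • (D.x b 0 * D.derAdd (k, i) (ξ (k, i)) v) := by
  obtain ⟨U, c, b, hc, hb, h₁, h₂, h₃⟩ := D.exists_coordinate (k, 1 - i)
  have hi : i ≠ 1 - i := by fin_cases i <;> simp
  -- For `i = 0` it is `∂_{(k,1)} U` that survives, and it enters the block with a minus sign.
  refine ⟨U, if i = 0 then -c else c, D.wt k + b, by split_ifs <;> simpa, ?_, ⟨c, b, hc, h₁⟩, ?_⟩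
  · rw [map_add, hb _ (by simpa using hi), add_zero]
  · intro ξ f hf v
    rw [poi, h₃ f hf, add_zero, Finset.sum_eq_single k]
    · rw [show D.x (D.wt k + b) 0 = D.x (D.wt k) 0 * D.x b 0 by rw [x_mul_x, add_zero]]
      fin_cases i
      · have e : D.der (k, 0) U = 0 := h₂ _ (by simp)
        have e' : D.der (k, 1) U = c • D.x b 0 := h₁
        simp [blk, e, e', mul_assoc]
      · have e : D.der (k, 1) U = 0 := h₂ _ (by simp)
        have e' : D.der (k, 0) U = c • D.x b 0 := h₁
        simp [blk, e, e', mul_assoc]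
    · intro l _ hl
      simp [blk, h₂ (l, 0) (by simp [hl]), h₂ (l, 1) (by simp [hl])]
    · simp

theorem isUnit_x (α : Γ) : IsUnit (D.x α 0) := IsUnit.of_mul_eq_one _ (D.x_mul_x_neg α)

theorem isUnit_smul_x {c : F} (hc : c ≠ 0) (α : Γ) : IsUnit (c • D.x α 0) := by
  rw [Algebra.smul_def]
  exact ((IsUnit.mk0 c hc).map (algebraMap F D.Alg)).mul (D.isUnit_x α)

theorem exists_isUnit_poi (k : Fin (m + 1)) (i : Fin 2) {θ : D.Alg} {c : F} {b : Γ} (hc : c ≠ 0)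
    (h : D.der (k, i) θ = c • D.x b 0) : ∃ s, IsUnit (D.poi 0 0 s θ) := by
  obtain ⟨U, c', b', hc', -, -, hU⟩ := D.exists_poi_eq_derAdd k i
  refine ⟨U, ?_⟩
  rw [hU 0 0 (by simp), Pi.zero_apply, derAdd_zero, h, mul_smul_comm, x_mul_x, add_zero, smul_smul]
  exact D.isUnit_smul_x (mul_ne_zero hc' hc) _

end Coordinates

/-! ### Coefficients -/

section Coefficients

open Classical in
/-- The coefficient of `x^{α,i}`, which is `0` if `i` is not in `𝒥`. -/
noncomputable def cf (α : Γ) (i : Fin (m + 1) × Fin 2 → ℕ) : D.Alg →ₗ[F] F :=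
  if h : i ∈ D.JJ then
    Finsupp.lapply (α, ⟨i, h⟩) ∘ₗ (AddMonoidAlgebra.coeffLinearEquiv F).toLinearMap
  else 0

open Classical in
theorem cf_x (α β : Γ) (i : Fin (m + 1) × Fin 2 → ℕ) (j : D.JJ) :
    D.cf α i (D.x β j) = if β = α ∧ j.1 = i then 1 else 0 := by
  by_cases h : i ∈ D.JJ
  · simp only [cf, h, dif_pos, x, LinearMap.comp_apply, Finsupp.lapply_apply]
    change Finsupp.single (β, j) (1 : F) (α, ⟨i, h⟩) = _
    rw [Finsupp.single_apply]
    simp only [Prod.mk.injEq, Subtype.ext_iff]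
  · have : ¬ (β = α ∧ j.1 = i) := fun hj => h (hj.2 ▸ j.2)
    simp [cf, h, this]

theorem ext_cf {v w : D.Alg} (h : ∀ α i, D.cf α i v = D.cf α i w) : v = w := by
  apply AddMonoidAlgebra.ext
  ext ⟨α, i⟩
  have := h α i.1
  simp only [cf, i.2, dif_pos, Subtype.coe_eta] at this
  exact this

theorem exists_cf_ne_zero {v : D.Alg} (hv : v ≠ 0) : ∃ α i, D.cf α i v ≠ 0 := by
  by_contra! h
  exact hv (D.ext_cf fun α i => by rw [h, map_zero])

/-- No case distinction is needed when `i + 1_{[p]}` leaves `𝒥`, thanks to the value `0` of `cf`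
there. -/
theorem cf_der (p : Fin (m + 1) × Fin 2) (α : Γ) (i : Fin (m + 1) × Fin 2 → ℕ) (v : D.Alg) :
    D.cf α i (D.der p v)
      = D.φp p α * D.cf α i v + (i p + 1 : F) * D.cf α (i + Pi.single p 1) v := by
  induction v using D.alg_induction with
  | hadd u₁ u₂ h₁ h₂ =>
    simp only [map_add, h₁, h₂]
    ring
  | hsmul c u h =>
    simp only [map_smul, h, smul_eq_mul]
    ring
  | hx β j =>
    simp only [der_x, map_add, map_smul, cf_x, smul_eq_mul]
    congr 1
    · by_cases h : β = α
      · subst h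
        rfl
      · simp [h]
    · by_cases h : β = α
      · by_cases hj : j.1 = i + Pi.single p 1
        · have : (D.lower p j).1 = i := by simp [lower, hj]
          simp [h, hj, this]
        · by_cases hp : j.1 p = 0
          · simp [hj, hp]
          · have : (D.lower p j).1 ≠ i := by
              rintro rfl
              apply hj
              funext q
              by_cases hq : q = p
              · subst hq
                simp [lower]
                omega
              · simp [lower, hq]
            simp [hj, this]
      · simp [h]

/-- The diagonal operator with eigenvalue `φ(α,β) + f(α)` on `𝒜_β`. -/
noncomputable def weightOp (f : Γ →+ F) (α : Γ) (v : D.Alg) : D.Alg :=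
  D.x (-α) 0 * D.formMul f (D.x α 0) v

theorem cf_weightOp (f : Γ →+ F) (α β : Γ) (i : Fin (m + 1) × Fin 2 → ℕ) (v : D.Alg) :
    D.cf β i (D.weightOp f α v) = (D.φ α β + f α) * D.cf β i v := by
  induction v using D.alg_induction with
  | hadd u₁ u₂ h₁ h₂ => simp only [weightOp, mul_add, map_add] at *; rw [h₁, h₂]
  | hsmul c u h =>
    simp only [weightOp, mul_smul_comm, map_smul, smul_eq_mul] at *
    rw [h]
    ring
  | hx γ j =>
    rw [weightOp, formMul_x, mul_smul_comm, x_mul_x, x_mul_x, neg_add_cancel_left, map_smul, zero_add, zero_add,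
      smul_eq_mul]
    by_cases h : γ = β
    · rw [h]
    · simp [cf_x, h]

theorem exists_degree_bound (v : D.Alg) : ∃ d : ℕ, ∀ α i, d ≤ ∑ p, i p → D.cf α i v = 0 := by
  induction v using D.alg_induction with
  | hadd u₁ u₂ h₁ h₂ =>
    obtain ⟨d₁, h₁⟩ := h₁
    obtain ⟨d₂, h₂⟩ := h₂
    refine ⟨max d₁ d₂, fun α i h => ?_⟩
    rw [map_add, h₁ α i (le_of_max_le_left h), h₂ α i (le_of_max_le_right h), add_zero]
  | hsmul c u h =>
    obtain ⟨d, h⟩ := h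
    exact ⟨d, fun α i hi => by rw [map_smul, h α i hi, smul_zero]⟩
  | hx β j =>
    refine ⟨∑ p, j.1 p + 1, fun α i hi => ?_⟩
    rw [cf_x, if_neg]
    rintro ⟨-, rfl⟩
    omega

theorem exists_weight_support (v : D.Alg) :
    ∃ S : Finset Γ, ∀ α, α ∉ S → ∀ i, D.cf α i v = 0 := by
  classical
  induction v using D.alg_induction with
  | hadd u₁ u₂ h₁ h₂ =>
    obtain ⟨S₁, h₁⟩ := h₁
    obtain ⟨S₂, h₂⟩ := h₂
    refine ⟨S₁ ∪ S₂, fun α h i => ?_⟩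
    rw [Finset.mem_union, not_or] at h
    rw [map_add, h₁ α h.1 i, h₂ α h.2 i, add_zero]
  | hsmul c u h =>
    obtain ⟨S, h⟩ := h
    exact ⟨S, fun α hα i => by rw [map_smul, h α hα i, smul_zero]⟩
  | hx β j =>
    refine ⟨{β}, fun α hα i => ?_⟩
    rw [cf_x, if_neg]
    rintro ⟨rfl, -⟩
    simp at hα

theorem exists_top_degree {v : D.Alg} {β : Γ} (h : ∃ i, D.cf β i v ≠ 0) :
    ∃ i, D.cf β i v ≠ 0 ∧ ∀ j, ∑ p, i p < ∑ p, j p → D.cf β j v = 0 := by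
  obtain ⟨d, hd⟩ := D.exists_degree_bound v
  obtain ⟨i₀, h₀⟩ := h
  let T : Set ℕ := {n | ∃ i, D.cf β i v ≠ 0 ∧ ∑ p, i p = n}
  have hb : BddAbove T := by
    refine ⟨d, ?_⟩
    rintro _ ⟨i, hi, rfl⟩
    by_contra! hlt
    exact hi (hd β i hlt.le)
  obtain ⟨i, hi, hs⟩ := Nat.sSup_mem (s := T) ⟨_, i₀, h₀, rfl⟩ hb
  refine ⟨i, hi, fun j hj => ?_⟩
  by_contra hne
  have := le_csSup hb (show ∑ p, j p ∈ T from ⟨j, hne, rfl⟩)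
  omega

theorem sum_add_single {ι : Type*} [Fintype ι] [DecidableEq ι] (i : ι → ℕ) (p : ι) :
    ∑ q, (i + Pi.single p 1 : ι → ℕ) q = ∑ q, i q + 1 := by
  simp [Finset.sum_add_distrib]

theorem eq_of_forall_φ_of_forall_φp {α β : Γ} (h : ∀ γ, D.φ γ α = D.φ γ β)
    (h' : ∀ p, D.φp p α = D.φp p β) : α = β := by
  rw [← sub_eq_zero]
  have hmem : α - β ∈ D.φ.ker ⊓ ⨅ p, (D.φp p).ker := by
    refine AddSubgroup.mem_inf.2 ⟨?_, ?_⟩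
    · rw [AddMonoidHom.mem_ker]
      ext γ
      rw [D.φ_skew, map_sub, h, sub_self, neg_zero, AddMonoidHom.zero_apply]
    · simp [AddSubgroup.mem_iInf, AddMonoidHom.mem_ker, h']
  rwa [D.rad_inf_ker, AddSubgroup.mem_bot] at hmem

end Coefficients

/-! ### Ideals stable under the derivations and the weight operators -/

section Simplicity

variable {D} {K : Ideal D.Alg} {f : Γ →+ F}

theorem smul_mem_ideal (c : F) {v : D.Alg} (hv : v ∈ K) : c • v ∈ K := by
  rw [Algebra.smul_def]
  exact K.mul_mem_left _ hv

theorem smul_mem_ideal_iff {c : F} (hc : c ≠ 0) {v : D.Alg} : c • v ∈ K ↔ v ∈ K := by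
  refine ⟨fun h => ?_, smul_mem_ideal c⟩
  simpa [smul_smul, hc] using smul_mem_ideal c⁻¹ h

/-- Distinct weights differ under `φ` or under some `φ_p`. In the first case, a weight operator
minus its eigenvalue kills the `α`-part at once. In the second, `∂_p - φ_p(α)` lowers the degree of
the `α`-part while multiplying the top-degree coefficients at `β` by a nonzero scalar, so iteration
terminates with the `β`-part alive. -/
theorem exists_remove_weight (hder : ∀ p, ∀ v ∈ K, D.der p v ∈ K)
    (hwt : ∀ α, ∀ v ∈ K, D.weightOp f α v ∈ K) {α β : Γ} (hαβ : α ≠ β) (d : ℕ) :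
    ∀ v ∈ K, (∀ i, d ≤ ∑ p, i p → D.cf α i v = 0) → (∃ i, D.cf β i v ≠ 0) →
      ∃ v' ∈ K, (∀ i, D.cf α i v' = 0) ∧ (∃ i, D.cf β i v' ≠ 0) ∧
        ∀ γ, (∀ i, D.cf γ i v = 0) → ∀ i, D.cf γ i v' = 0 := by
  induction d with
  | zero => exact fun v hv hd hβ => ⟨v, hv, fun i => hd i (Nat.zero_le _), hβ, fun γ h => h⟩
  | succ d ih =>
    intro v hv hd hβ
    by_cases hγ : ∃ γ, D.φ γ α ≠ D.φ γ β
    · obtain ⟨γ, hγ⟩ := hγ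
      obtain ⟨i, hi⟩ := hβ
      refine ⟨D.weightOp f γ v - (D.φ γ α + f γ) • v,
        K.sub_mem (hwt γ v hv) (smul_mem_ideal _ hv), fun j => ?_, ⟨i, ?_⟩, fun δ hδ j => ?_⟩
      · rw [map_sub, map_smul, cf_weightOp, smul_eq_mul, sub_self]
      · rw [map_sub, map_smul, cf_weightOp, smul_eq_mul, ← sub_mul]
        refine mul_ne_zero ?_ hi
        rw [add_sub_add_right_eq_sub]
        exact sub_ne_zero.2 hγ.symm
      · rw [map_sub, map_smul, cf_weightOp, hδ, mul_zero, smul_zero, sub_zero]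
    · push Not at hγ
      have hp : ∃ p, D.φp p α ≠ D.φp p β := by
        by_contra! hp
        exact hαβ (D.eq_of_forall_φ_of_forall_φp hγ hp)
      obtain ⟨p, hp⟩ := hp
      have e : ∀ γ j, D.cf γ j (D.der p v - D.φp p α • v)
          = (D.φp p γ - D.φp p α) * D.cf γ j v
            + (j p + 1 : F) * D.cf γ (j + Pi.single p 1) v := by
        intro γ j
        rw [map_sub, map_smul, cf_der, smul_eq_mul]
        ring
      obtain ⟨i, hi, hi'⟩ := D.exists_top_degree hβ
      obtain ⟨v', hv', h₁, h₂, h₃⟩ := ih (D.der p v - D.φp p α • v)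
        (K.sub_mem (hder p v hv) (smul_mem_ideal _ hv))
        (fun j hj => by
          rw [e, sub_self, zero_mul, zero_add, hd (j + Pi.single p 1) (by rw [sum_add_single]; omega), mul_zero])
        ⟨i, by
          rw [e, hi' (i + Pi.single p 1) (by rw [sum_add_single]; omega), mul_zero, add_zero]
          exact mul_ne_zero (sub_ne_zero.2 hp.symm) hi⟩
      exact ⟨v', hv', h₁, h₂, fun γ hγ => h₃ γ fun j => by rw [e, hγ, hγ, mul_zero, mul_zero,
        add_zero]⟩

/-- On weight `β` the operator `∂_p - φ_p(β)` is plain differentiation in the `p`-th variable. In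
characteristic `0` this reduces `v` to a nonzero multiple of `x^{β,0}`, which is a unit. -/
theorem eq_top_of_single_weight [CharZero F] (hder : ∀ p, ∀ v ∈ K, D.der p v ∈ K) {β : Γ} (d : ℕ) :
    ∀ v ∈ K, v ≠ 0 → (∀ γ, γ ≠ β → ∀ i, D.cf γ i v = 0) →
      (∀ i, d ≤ ∑ p, i p → D.cf β i v = 0) → K = ⊤ := by
  induction d with
  | zero =>
    intro v hv hne h₁ h₂
    refine absurd (D.ext_cf fun γ i => ?_) hne
    rw [map_zero]
    by_cases hγ : γ = β
    · subst hγ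
      exact h₂ i (Nat.zero_le _)
    · exact h₁ γ hγ i
  | succ d ih =>
    intro v hv hne h₁ h₂
    by_cases h : ∃ i, i ≠ 0 ∧ D.cf β i v ≠ 0
    · obtain ⟨i, hi, hi'⟩ := h
      obtain ⟨p, hp⟩ := Function.ne_iff.1 hi
      have e : ∀ γ j, D.cf γ j (D.der p v - D.φp p β • v)
          = (D.φp p γ - D.φp p β) * D.cf γ j v
            + (j p + 1 : F) * D.cf γ (j + Pi.single p 1) v := by
        intro γ j
        rw [map_sub, map_smul, cf_der, smul_eq_mul]
        ring
      refine ih _ (K.sub_mem (hder p v hv) (smul_mem_ideal (D.φp p β) hv)) ?_ ?_ ?_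
      · intro h0
        have h3 := e β (i - Pi.single p 1)
        have : i - Pi.single p 1 + Pi.single p 1 = i := by
          funext q
          by_cases hq : q = p
          · subst hq
            simp at hp ⊢
            omega
          · simp [hq]
        rw [h0, map_zero, sub_self, zero_mul, zero_add, this] at h3
        exact mul_ne_zero (Nat.cast_add_one_ne_zero _) hi' h3.symm
      · intro γ hγ j
        rw [e, h₁ γ hγ, h₁ γ hγ, mul_zero, mul_zero, add_zero]
      · intro j hj
        rw [e, sub_self, zero_mul, zero_add, h₂ (j + Pi.single p 1) (by rw [sum_add_single]; omega), mul_zero]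
    · push Not at h
      have e : v = D.cf β 0 v • D.x β 0 := by
        refine D.ext_cf fun γ i => ?_
        rw [map_smul, cf_x, smul_eq_mul]
        by_cases hγ : γ = β
        · subst hγ
          by_cases hi : i = 0
          · simp [hi]
          · simp [h i hi, Ne.symm hi]
        · simp [h₁ γ hγ, Ne.symm hγ]
      have hc : D.cf β 0 v ≠ 0 := by
        intro hc
        rw [hc, zero_smul] at e
        exact hne e
      exact K.eq_top_of_isUnit_mem hv (e ▸ D.isUnit_smul_x hc β)

theorem eq_top_of_stable [CharZero F] (hder : ∀ p, ∀ v ∈ K, D.der p v ∈ K)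
    (hwt : ∀ α, ∀ v ∈ K, D.weightOp f α v ∈ K) (hK : K ≠ ⊥) : K = ⊤ := by
  classical
  obtain ⟨v, hv, hne⟩ := K.ne_bot_iff.1 hK
  obtain ⟨S, hS⟩ := D.exists_weight_support v
  induction S using Finset.strongInduction generalizing v with
  | H S ih =>
    obtain ⟨β, hβ⟩ := D.exists_cf_ne_zero hne
    by_cases h : ∃ α ∈ S, α ≠ β
    · obtain ⟨α, hα, hαβ⟩ := h
      obtain ⟨d, hd⟩ := D.exists_degree_bound v
      obtain ⟨v', hv', h₁, ⟨i, hi⟩, h₃⟩ :=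
        exists_remove_weight hder hwt hαβ d v hv (hd α) hβ
      refine ih _ (Finset.erase_ssubset hα) v' hv' ?_ ?_
      · rintro rfl
        exact hi (map_zero _)
      · intro γ hγ
        by_cases hγα : γ = α
        · exact hγα ▸ h₁
        · exact h₃ γ (hS γ fun hγS => hγ (Finset.mem_erase.2 ⟨hγα, hγS⟩))
    · push Not at h
      obtain ⟨d, hd⟩ := D.exists_degree_bound v
      exact eq_top_of_single_weight hder d v hv hne (fun γ hγ => hS γ fun hγS => hγ (h γ hγS))
        (hd β)

/-- Unit factors can be cancelled in an ideal, so the conjugate coordinates give stability under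
each `∂_p + ξ_p`, hence under `∂_p`. Removing the blocks from `P_{x^α}` then leaves the weight
operators. -/
theorem eq_top_of_poi_stable [CharZero F] {ξ : Fin (m + 1) × Fin 2 → F} (hf : D.φ.ker ≤ f.ker)
    (hP : ∀ u, ∀ v ∈ K, D.poi ξ f u v ∈ K) (hK : K ≠ ⊥) : K = ⊤ := by
  have hderAdd : ∀ p, ∀ v ∈ K, D.derAdd p (ξ p) v ∈ K := by
    rintro ⟨k, i⟩ v hv
    obtain ⟨U, c, b, hc, -, -, hU⟩ := D.exists_poi_eq_derAdd k i
    have h := hP U v hv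
    rw [hU ξ f hf, smul_mem_ideal_iff hc] at h
    exact (K.unit_mul_mem_iff_mem (D.isUnit_x b)).1 h
  refine eq_top_of_stable (f := f) (fun p v hv => ?_) (fun α v hv => ?_) hK
  · have h := K.sub_mem (hderAdd p v hv) (smul_mem_ideal (ξ p) hv)
    rwa [derAdd_apply, add_sub_cancel_right] at h
  · refine K.mul_mem_left _ ?_
    have h : ∑ k, D.blk ξ k (D.x α 0) v ∈ K := K.sum_mem fun k _ =>
      K.mul_mem_left _ (K.sub_mem (K.mul_mem_left _ (hderAdd _ v hv))
        (K.mul_mem_left _ (hderAdd _ v hv)))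
    have h' := K.sub_mem (hP (D.x α 0) v hv) h
    rwa [poi, add_sub_cancel_left] at h'

theorem poiIdeal_ne_bot {ξ : Fin (m + 1) × Fin 2 → F} (hf : D.φ.ker ≤ f.ker)
    (hμ : ¬ ∃ μ : Γ, (∀ p, ξ p = D.φp p μ) ∧ ∀ α : Γ, f α = D.φ α μ) {N : Submodule F D.Alg}
    (hN : N ≠ ⊥) : D.poiIdeal ξ f N ≠ ⊥ := by
  intro hbot
  obtain ⟨v, hv, hne⟩ := N.ne_bot_iff.1 hN
  have hP : ∀ u, D.poi ξ f u v = 0 := by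
    intro u
    have : D.poi ξ f u v ∈ D.poiIdeal ξ f N := Ideal.subset_span ⟨u, v, hv, rfl⟩
    rwa [hbot, Ideal.mem_bot] at this
  have hder : ∀ p, D.derAdd p (ξ p) v = 0 := by
    rintro ⟨k, i⟩
    obtain ⟨U, c, b, hc, -, -, hU⟩ := D.exists_poi_eq_derAdd k i
    have h := hP U
    rw [hU ξ f hf] at h
    exact (D.isUnit_x b).mul_right_eq_zero.1 ((smul_eq_zero.1 h).resolve_left hc)
  have hwt : ∀ α, D.weightOp f α v = 0 := by
    intro α
    have h := hP (D.x α 0)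
    simp only [poi, blk, hder, mul_zero, sub_zero, Finset.sum_const_zero, zero_add] at h
    rw [weightOp, h, mul_zero]
  obtain ⟨β, hβ⟩ := D.exists_cf_ne_zero hne
  obtain ⟨i, hi, hi'⟩ := D.exists_top_degree hβ
  -- At a top-degree coefficient of weight `β` the lowering terms vanish, leaving `φ_p(β) + ξ_p = 0`
  -- and `φ(α,β) + f(α) = 0`.
  refine hμ ⟨-β, fun p => ?_, fun α => ?_⟩
  · have h := congrArg (D.cf β i) (hder p)
    rw [derAdd_apply, map_add, map_smul, cf_der, hi' (i + Pi.single p 1) (by rw [sum_add_single]; omega), mul_zero,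
      add_zero, smul_eq_mul, ← add_mul, map_zero] at h
    rw [map_neg]
    exact eq_neg_of_add_eq_zero_right ((mul_eq_zero.1 h).resolve_right hi)
  · have h := congrArg (D.cf β i) (hwt α)
    rw [cf_weightOp, map_zero] at h
    rw [map_neg]
    exact eq_neg_of_add_eq_zero_right ((mul_eq_zero.1 h).resolve_right hi)

end Simplicity

/-! ### The submodule generated by the images is everything -/

section Images

theorem derAdd_x (p : Fin (m + 1) × Fin 2) (c : F) (α : Γ) (i : D.JJ) :
    D.derAdd p c (D.x α i) = (D.φp p α + c) • D.x α i + (i.1 p : F) • D.x α (D.lower p i) := by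
  rw [derAdd_apply, der_x]
  module

/-- Where `φ_p(α) + c = 0` the operator is differentiation and one integrates; elsewhere it is
triangular in `i_p` with nonzero diagonal. -/
theorem derAdd_surjective [CharZero F] {p : Fin (m + 1) × Fin 2} (hp : D.J p = ⊤) (c : F) :
    Function.Surjective (D.derAdd p c) := by
  rw [← LinearMap.range_eq_top, Submodule.eq_top_iff']
  have key : ∀ α (n : ℕ) (i : D.JJ), i.1 p = n → D.x α i ∈ LinearMap.range (D.derAdd p c) := by
    intro α n
    by_cases h : D.φp p α + c = 0
    · intro i _
      have hmem : i.1 + Pi.single p 1 ∈ D.JJ := by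
        refine D.JJ.add_mem i.2 ?_
        simp only [JJ, AddSubmonoid.mem_pi, Set.mem_univ, true_imp_iff]
        intro q
        by_cases hq : q = p
        · subst hq
          rw [hp]
          trivial
        · simp [hq]
      have e := D.derAdd_x p c α ⟨i.1 + Pi.single p 1, hmem⟩
      have hl : D.lower p ⟨i.1 + Pi.single p 1, hmem⟩ = i := by
        apply Subtype.ext
        simp [lower]
      rw [h, zero_smul, zero_add, hl] at e
      rw [← Submodule.smul_mem_iff _ (show ((i.1 p + 1 : ℕ) : F) ≠ 0 from
        Nat.cast_ne_zero.2 (Nat.succ_ne_zero _))]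
      refine ⟨_, e.trans ?_⟩
      simp
    · induction n with
      | zero =>
        intro i hi
        rw [← Submodule.smul_mem_iff _ h]
        refine ⟨D.x α i, ?_⟩
        simp [derAdd_x, hi]
      | succ n ih =>
        intro i hi
        have hl := ih (D.lower p i) (by simp [lower, hi])
        rw [← Submodule.smul_mem_iff _ h]
        have e := D.derAdd_x p c α i
        rw [← sub_eq_iff_eq_add] at e
        rw [← e]
        exact Submodule.sub_mem _ ⟨_, rfl⟩ (Submodule.smul_mem _ _ hl)
  intro v
  induction v using D.alg_induction with
  | hadd u₁ u₂ h₁ h₂ => exact Submodule.add_mem _ h₁ h₂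
  | hsmul c' u h => exact Submodule.smul_mem _ _ h
  | hx α i => exact key α _ i rfl

theorem eq_top_of_x_mem {N : Submodule F D.Alg} (h : ∀ α i, D.x α i ∈ N) : N = ⊤ := by
  rw [Submodule.eq_top_iff']
  intro v
  induction v using D.alg_induction with
  | hadd u₁ u₂ h₁ h₂ => exact Submodule.add_mem _ h₁ h₂
  | hsmul c' u h => exact Submodule.smul_mem _ _ h
  | hx α i => exact h α i

theorem poi_x_x (ξ : Fin (m + 1) × Fin 2 → F) (f : Γ →+ F) (α β : Γ) :
    D.poi ξ f (D.x α 0) (D.x β 0)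
      = ∑ k, (D.φp (k, 0) α * (D.φp (k, 1) β + ξ (k, 1))
          - D.φp (k, 1) α * (D.φp (k, 0) β + ξ (k, 0))) • D.x (α + β + D.wt k) 0
        + (D.φ α β + f α) • D.x (α + β) 0 := by
  rw [poi, formMul_x, x_mul_x, add_zero]
  congr 1
  refine Finset.sum_congr rfl fun k _ => ?_
  have e : D.x (α + β + D.wt k) 0 = D.x (D.wt k) 0 * (D.x α 0 * D.x β 0) := by
    rw [x_mul_x, x_mul_x, add_zero, add_zero, add_comm]
  rw [e, blk, der_x_zero, der_x_zero, derAdd_apply, derAdd_apply, der_x_zero, der_x_zero]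
  simp only [Algebra.smul_def, map_sub, map_mul, map_add]
  ring

theorem eq_top_of_poi_mem [CharZero F] {ξ : Fin (m + 1) × Fin 2 → F} {f : Γ →+ F}
    (hf : D.φ.ker ≤ f.ker)
    (hμ : ¬ ∃ μ : Γ, (∀ p, ξ p = D.φp p μ) ∧ ∀ α : Γ, f α = D.φ α μ) {N : Submodule F D.Alg}
    (hN : ∀ θ s, IsUnit (D.poi 0 0 s θ) → ∀ w, D.poi ξ f θ w ∈ N) : N = ⊤ := by
  have himg : ∀ k i, ∃ b : Γ, D.φp (k, i) b = D.φp (k, i) (D.wt k) ∧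
      ∀ w, D.x b 0 * D.derAdd (k, i) (ξ (k, i)) w ∈ N := by
    intro k i
    obtain ⟨U, c, b, hc, hb, ⟨c', b', hc', hU'⟩, hU⟩ := D.exists_poi_eq_derAdd k i
    obtain ⟨s, hs⟩ := D.exists_isUnit_poi k (1 - i) hc' hU'
    refine ⟨b, hb, fun w => ?_⟩
    have h := hN U s hs w
    rwa [hU ξ f hf, N.smul_mem_iff hc] at h
  -- One polynomial variable already makes a single image everything. Without any, `𝒜` is the group
  -- algebra of `Γ` and each monomial is tested separately.
  by_cases hJ : ∃ p, D.J p = ⊤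
  · obtain ⟨⟨k, i⟩, hp⟩ := hJ
    obtain ⟨b, -, hb⟩ := himg k i
    rw [Submodule.eq_top_iff']
    intro v
    obtain ⟨w, hw⟩ := D.derAdd_surjective hp (ξ (k, i)) (D.x (-b) 0 * v)
    have h := hb w
    rwa [hw, ← mul_assoc, x_mul_x_neg, one_mul] at h
  · push Not at hJ
    have hzero : ∀ i : D.JJ, i = 0 := by
      intro i
      have hi := i.2
      simp only [JJ, AddSubmonoid.mem_pi, Set.mem_univ, true_imp_iff] at hi
      apply Subtype.ext
      funext p
      have h := hi p
      rw [(D.J_eq p).resolve_right (hJ p), AddSubmonoid.mem_bot] at h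
      exact h
    have hmem : ∀ γ k i, D.φp (k, i) (γ - D.wt k) + ξ (k, i) ≠ 0 → D.x γ 0 ∈ N := by
      intro γ k i h
      obtain ⟨b, hb, hb'⟩ := himg k i
      have h' := hb' (D.x (γ - b) 0)
      rw [derAdd_apply, der_x_zero, ← add_smul, mul_smul_comm, x_mul_x, add_sub_cancel, add_zero,
        N.smul_mem_iff] at h'
      · exact h'
      · rwa [map_sub, hb, ← map_sub]
    refine D.eq_top_of_x_mem fun γ i => ?_
    rw [hzero i]
    by_contra hγ
    -- A monomial outside `N` is missed by the images of all conjugate coordinates.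
    have hγ' : ∀ k i, D.φp (k, i) γ + ξ (k, i) = D.φp (k, i) (D.wt k) := by
      intro k i
      by_contra h
      refine hγ (hmem γ k i fun h' => h ?_)
      rw [map_sub] at h'
      linear_combination h'
    have hS : ∀ k i, D.φp (k, i) (∑ l, D.wt l) = D.φp (k, i) (D.wt k) := by
      intro k i
      rw [map_sum]
      exact Finset.sum_eq_single k (fun l _ hl => D.φp_wt l k hl.symm i) (by simp)
    have hSφ : ∀ α, D.φ α (∑ l, D.wt l) = 0 := by
      intro α
      have h : ∑ l, D.wt l ∈ D.φ.ker := sum_mem fun l _ => D.wt_mem_rad l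
      rw [AddMonoidHom.mem_ker] at h
      rw [D.φ_skew, h, AddMonoidHom.zero_apply, neg_zero]
    -- Otherwise `μ = ∑ wt l - γ` would be of the excluded kind: the sum is in the radical, and
    -- `φ_{(k,i)}` sees only its `k`-th term.
    obtain ⟨α, hα⟩ : ∃ α, D.φ α γ + f α ≠ 0 := by
      by_contra! h
      refine hμ ⟨∑ l, D.wt l - γ, ?_, fun α => ?_⟩
      · rintro ⟨k, i⟩
        rw [map_sub, hS]
        linear_combination hγ' k i
      · rw [map_sub, hSφ]
        linear_combination h α
    -- Shifting by `ε` changes `φ_1` but neither `φ(·,γ)` nor `f`; `φ_1(θ) ≠ 0` guarantees an `s`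
    -- with `{s, x^θ}` a unit.
    obtain ⟨θ, hθ, hθ'⟩ : ∃ θ, D.φ θ γ + f θ ≠ 0 ∧ D.φp (0, 0) θ ≠ 0 := by
      by_cases h : D.φp (0, 0) α = 0
      · have h₁ : D.φ D.ε = 0 := D.ε_mem_rad
        have h₂ : f D.ε = 0 := hf D.ε_mem_rad
        exact ⟨α + D.ε, by simpa [h₁, h₂] using hα, by simp [h, D.φp_ε_one]⟩
      · exact ⟨α, hα, h⟩
    obtain ⟨s, hs⟩ := D.exists_isUnit_poi 0 0 hθ' (D.der_x_zero (0, 0) θ)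
    have h := hN _ s hs (D.x (γ - θ) 0)
    have hθθ : D.φ θ θ = 0 := self_eq_neg.1 (D.φ_skew θ θ)
    rw [poi_x_x, add_sub_cancel, map_sub, hθθ, sub_zero] at h
    refine hγ ((N.smul_mem_iff hθ).1 ((N.add_mem_iff_right (N.sum_mem fun k _ => ?_)).1 h))
    -- The other terms of `P_{x^θ}(x^{γ-θ})` are multiples of `x^{γ + wt k}`. Either this monomial
    -- is not missed by an image, or both `φ_{(k,i)}(γ) + ξ_{(k,i)}` vanish and its coefficient is
    -- `0`.
    by_cases hk : ∃ i, D.φp (k, i) (D.wt k) ≠ 0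
    · obtain ⟨i, hi⟩ := hk
      refine N.smul_mem _ (hmem _ k i ?_)
      rwa [add_sub_cancel_right, hγ']
    · push Not at hk
      have h₀ := hγ' k 0
      have h₁ := hγ' k 1
      rw [hk] at h₀ h₁
      convert N.zero_mem
      rw [smul_eq_zero]
      left
      rw [map_sub, map_sub]
      linear_combination D.φp (k, 0) θ * h₁ - D.φp (k, 1) θ * h₀

theorem eq_top_of_ne_bot_of_poi_stable [CharZero F] {ξ : Fin (m + 1) × Fin 2 → F} {f : Γ →+ F}
    (hf : D.φ.ker ≤ f.ker)
    (hμ : ¬ ∃ μ : Γ, (∀ p, ξ p = D.φp p μ) ∧ ∀ α : Γ, f α = D.φ α μ) {N : Submodule F D.Alg}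
    (hN : ∀ u, ∀ v ∈ N, D.poi ξ f u v ∈ N) (hbot : N ≠ ⊥) : N = ⊤ := by
  have hK : D.poiIdeal ξ f N = ⊤ := eq_top_of_poi_stable hf
    (fun u _ hv => D.poi_mem_poiIdeal hN u hv) (poiIdeal_ne_bot hf hμ hbot)
  exact D.eq_top_of_poi_mem hf hμ fun _ _ hs w => D.poi_mem_of_poiIdeal_eq_top hN hK hs w

end Images

/-! ### The untwisting isomorphism -/

section Untwisting

variable {ξ : Fin (m + 1) × Fin 2 → F} {f : Γ →+ F} {μ : Γ}

theorem der_x_mul (hξ : ∀ p, ξ p = D.φp p μ) (p : Fin (m + 1) × Fin 2) (v : D.Alg) :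
    D.der p (D.x μ 0 * v) = D.x μ 0 * D.derAdd p (ξ p) v := by
  rw [der_mul, der_x_zero, derAdd_apply, hξ, smul_mul_assoc, mul_add, mul_smul_comm]
  exact add_comm _ _

theorem formMul_x_mul (hfμ : ∀ α, f α = D.φ α μ) (u v : D.Alg) :
    D.formMul 0 u (D.x μ 0 * v) = D.x μ 0 * D.formMul f u v := by
  induction u using D.alg_induction with
  | hadd u₁ u₂ h₁ h₂ => simp only [map_add, LinearMap.add_apply, h₁, h₂, mul_add]
  | hsmul c u h => simp only [map_smul, LinearMap.smul_apply, h, mul_smul_comm]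
  | hx α i =>
    induction v using D.alg_induction with
    | hadd u₁ u₂ h₁ h₂ => simp only [mul_add, map_add, h₁, h₂]
    | hsmul c u h => simp only [mul_smul_comm, map_smul, h]
    | hx β j =>
      rw [x_mul_x, formMul_x, formMul_x, ← x_mul_x, mul_smul_comm, mul_left_comm, hfμ, map_add,
        AddMonoidHom.zero_apply, add_zero, add_comm (D.φ α μ)]

theorem poi_zero_x_mul (hξ : ∀ p, ξ p = D.φp p μ) (hfμ : ∀ α, f α = D.φ α μ) (u v : D.Alg) :
    D.poi 0 0 u (D.x μ 0 * v) = D.x μ 0 * D.poi ξ f u v := by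
  have h : ∀ k, D.blk 0 k u (D.x μ 0 * v) = D.x μ 0 * D.blk ξ k u v := by
    intro k
    simp only [blk, Pi.zero_apply, derAdd_zero, D.der_x_mul hξ]
    ring
  simp only [poi, h, D.formMul_x_mul hfμ, mul_add, Finset.mul_sum]

theorem ξ₀_eq (p : Fin (m + 1) × Fin 2) : (ξ₀ p : F) = D.φp p D.ε := by
  by_cases hp : p = (0, 0)
  · subst hp
    simp [ξ₀, D.φp_ε_one]
  · simp [ξ₀, D.φp_ε p hp, hp]

/-- Both actions are compared with the untwisted `P`: multiplication by `x^μ` untwists `(ξ, f)`, and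
by `x^ε` it untwists `(ξ₀, 0)`. -/
theorem actFun_ξ₀_x_mul (hf : D.φ.ker ≤ f.ker) (hξ : ∀ p, ξ p = D.φp p μ)
    (hfμ : ∀ α, f α = D.φ α μ) (u v : D.Alg) :
    D.actFun ξ₀ 0 u (D.x (-D.ε) 0 * (D.x μ 0 * v))
      = D.x (-D.ε) 0 * (D.x μ 0 * D.actFun ξ f u v) := by
  have hε : ∀ α, (0 : Γ →+ F) α = D.φ α D.ε := by
    intro α
    have h : D.φ D.ε = 0 := D.ε_mem_rad
    simp [D.φ_skew α, h]
  rw [D.actFun_eq_poi ξ₀ (by simp), D.actFun_eq_poi ξ hf, ← D.poi_zero_x_mul hξ hfμ]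
  have h := D.poi_zero_x_mul D.ξ₀_eq hε (D.x D.ε 0 * u) (D.x (-D.ε) 0 * (D.x μ 0 * v))
  rw [← mul_assoc (D.x D.ε 0), x_mul_x_neg, one_mul] at h
  rw [h, ← mul_assoc (D.x (-D.ε) 0) (D.x D.ε 0), x_neg_mul_x, one_mul]

/-- Multiplication by the invertible element `x^{α,0}`. -/
noncomputable def mulX (α : Γ) : D.Alg ≃ₗ[F] D.Alg :=
  LinearEquiv.ofLinearMap (LinearMap.mulLeft F (D.x α 0)) (LinearMap.mulLeft F (D.x (-α) 0))
    (LinearMap.ext fun v => by simp [← mul_assoc, x_mul_x_neg])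
    (LinearMap.ext fun v => by simp [← mul_assoc, x_neg_mul_x])

/-- The isomorphism `𝒜_{ξ,f} ≅ 𝒜_{ξ₀,0}` for `ξ` and `f` that come from `μ ∈ Γ`. -/
noncomputable def modEquiv [CharZero F] (hf : D.φ.ker ≤ f.ker) (hξ : ∀ p, ξ p = D.φp p μ)
    (hfμ : ∀ α, f α = D.φ α μ) : D.Mod ξ f hf ≃ₗ⁅F, D.H⁆ D.Mod ξ₀ 0 (by simp) :=
  { ((D.toMod ξ f hf).symm.trans ((D.mulX μ).trans (D.mulX (-D.ε)))).trans
      (D.toMod ξ₀ 0 (by simp)) with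
    map_lie' := by
      intro h v
      obtain ⟨u, rfl⟩ := Submodule.Quotient.mk_surjective _ h
      exact (D.actFun_ξ₀_x_mul hf hξ hfμ (D.toLieA.symm u) ((D.toMod ξ f hf).symm v)).symm }

end Untwisting

end TwistedDatum

theorem theorem2 {F : Type*} [Field F] [CharZero F] {m : ℕ}
    {Γ : Type*} [AddCommGroup Γ] [IsAddTorsionFree Γ] [Nontrivial Γ]
    (D : TwistedDatum F m Γ)
    (ξ : Fin (m + 1) × Fin 2 → F) (f : Γ →+ F) (hf : D.φ.ker ≤ f.ker) :
    -- the module `𝒜_{ξ₀,0}` is the one induced from the adjoint representation of `𝒜`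
    (∀ u v : D.LieA,
      ⁅D.bar u, D.toMod TwistedDatum.ξ₀ 0 (by simp) (D.toLieA.symm v)⁆
        = D.toMod TwistedDatum.ξ₀ 0 (by simp) (D.toLieA.symm ⁅u, v⁆)) ∧
    ((∃ μ : Γ, (∀ p, ξ p = D.φp p μ) ∧ ∀ α : Γ, f α = D.φ α μ) →
      Nonempty (D.Mod ξ f hf ≃ₗ⁅F, D.H⁆ D.Mod TwistedDatum.ξ₀ 0 (by simp))) ∧
    ((¬ ∃ μ : Γ, (∀ p, ξ p = D.φp p μ) ∧ ∀ α : Γ, f α = D.φ α μ) →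
      LieModule.IsIrreducible F D.H (D.Mod ξ f hf)) := by
  refine ⟨fun u v => ?_, ?_, fun hμ => ?_⟩
  · have h := D.bar_lie TwistedDatum.ξ₀ 0 (by simp) (D.toLieA.symm u) (D.toLieA.symm v)
    rw [← D.brFun_eq_actFun] at h
    exact h
  · rintro ⟨μ, hξ, hfμ⟩
    exact ⟨D.modEquiv hf hξ hfμ⟩
  · have : Nontrivial (D.Mod ξ f hf) := inferInstanceAs (Nontrivial D.Alg)
    refine LieModule.IsIrreducible.mk fun N hN => ?_
    let N' : Submodule F D.Alg := N.toSubmodule.comap (D.toMod ξ f hf).toLinearMap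
    have hstable : ∀ u, ∀ v ∈ N', D.poi ξ f u v ∈ N' := by
      intro u v hv
      -- The factor `x^{-ε}` cancels the `x^ε` relating `actFun` to `poi`, so every `P_u` is
      -- realized.
      have h : ⁅D.bar (D.toLieA (D.x (-D.ε) 0 * u)), D.toMod ξ f hf v⁆ ∈ N := N.lie_mem hv
      rw [D.bar_lie, D.actFun_eq_poi ξ hf, ← mul_assoc, D.x_mul_x_neg, one_mul] at h
      exact h
    have hbot : N' ≠ ⊥ := by
      obtain ⟨v, hv, hne⟩ := (Submodule.ne_bot_iff _).1 ((LieSubmodule.toSubmodule_eq_bot N).not.2 hN)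
      exact (Submodule.ne_bot_iff _).2 ⟨(D.toMod ξ f hf).symm v, hv, hne⟩
    have htop := D.eq_top_of_ne_bot_of_poi_stable hf hμ hstable hbot
    rw [eq_top_iff]
    intro v _
    have h : (D.toMod ξ f hf).symm v ∈ N' := htop ▸ Submodule.mem_top
    exact h
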